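/- Algorithms are deterministic multi-tape (equivalently, multi-stack) Turing machines reading and writing bit strings; time is the number of steps. For a CNF $f:\{0,1\}^n\to\{0,1\}$ let $\#f=\sum_{x\in\{0,1\}^n}f(x)$. The strong exponential-time hypothesis (SETH) is the following statement: for every constant $a>0$ there is a constant $c>0$ such that, whenever a deterministic $T(n)$-time algorithm, given (a description of) a CNF $f:\{0,1\}^n\to\{0,1\}$ with at most $cn$ clauses, accepts if $\#f>0$ and rejects if $\#f=0$, then $T(n)>2^{(1-a)n}$ for infinitely many $n$. Theorem. Assume that SETH is true. Then for every constant $a>0$ there is a polynomial $p$ such that no deterministic algorithm exactly computes, within $2^{(1-a)h}$ steps, the acceptance probabilities of the $N$-qubit quantum circuits over classical gates (NOT, CNOT, TOFFOLI) and $h$ Hadamard gates with $N\le p(h)$. More precisely: for every deterministic algorithm $A$ there are infinitely many $h$ for which there exists an $N$-qubit quantum circuit $V$ that consists of classical gates (NOT, CNOT, TOFFOLI) and exactly $h$ Hadamard gates, such that (i) $N\le p(h)$, and the total number of gates of $V$ is at most $p(h)$; (ii) $\|(I^{\otimes N-1}\otimes|1\rangle\langle1|)V|0^N\rangle\|^2=\#f/2^h$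 for some CNF $f:\{0,1\}^h\to\{0,1\}$; (iii) given (a description of) $V$, the algorithm $A$ does not output the exact value of $\|(I^{\otimes N-1}\otimes|1\rangle\langle1|)V|0^N\rangle\|^2$ (as a finite binary expansion) within $2^{(1-a)h}$ steps. -/

import Mathlib

open Filter

namespace FineGrained

/-! ### Deterministic machines with a step count -/

/-- A deterministic multi-stack (equivalently, multi-tape) Turing machine with finitely many
control states, reading a bit string and writing a bit string. -/
abbrev Machine : Type 1 := Turing.TM2ComputableAux Bool Bool

/-- On input `w` the machine halts after at most `t` steps with output `out`. -/
def Machine.OutputsWithin (M : Machine) (w out : List Bool) (t : ℕ) : Prop :=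
  Nonempty (Turing.TM2OutputsInTime M.tm (w.map M.inputAlphabet.invFun)
    (some (out.map M.outputAlphabet.invFun)) t)

/-- Self-delimiting unary code of a natural number. -/
def unary (k : ℕ) : List Bool := List.replicate k true ++ [false]

/-- Self-delimiting code of a list, from self-delimiting codes of its entries. -/
def encodeList {α : Type} (enc : α → List Bool) (l : List α) : List Bool :=
  l.flatMap (fun x => true :: enc x) ++ [false]

/-! ### CNF formulas and SETH -/

/-- A clause over `n` variables: a finite set of literals. The literal `(i, true)` is the variable
`i` and `(i, false)` is its negation. -/
abbrev Clause (n : ℕ) : Type := Finset (Fin n × Bool)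

/-- A CNF over `n` variables: a list of clauses. -/
abbrev CNF (n : ℕ) : Type := List (Clause n)

/-- The Boolean function computed by a CNF. -/
def CNF.eval {n : ℕ} (f : CNF n) (x : Fin n → Bool) : Bool :=
  f.all fun C => decide (∃ l ∈ C, x l.1 = l.2)

/-- `#f`, the number of satisfying assignments. -/
def CNF.count {n : ℕ} (f : CNF n) : ℕ :=
  ∑ x : Fin n → Bool, (CNF.eval f x).toNat

/-- A clause is written as `2 n` bits, which say for each literal whether it occurs. -/
def encodeClause {n : ℕ} (C : Clause n) : List Bool :=
  (List.finRange n).flatMap fun i => [decide ((i, true) ∈ C), decide ((i, false) ∈ C)]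

/-- A CNF is written as its number of variables followed by the list of its clauses. -/
def encodeCNF {n : ℕ} (f : CNF n) : List Bool :=
  unary n ++ encodeList encodeClause f

/-- The strong exponential-time hypothesis: for every `a > 0` there is `c > 0` such that every
deterministic `T(n)`-time algorithm that decides whether `#f > 0`, for CNFs `f` with `n` variables
and at most `c n` clauses, has `T(n) > 2 ^ ((1 - a) n)` for infinitely many `n`. -/
def SETH : Prop :=
  ∀ a : ℝ, 0 < a → ∃ c : ℝ, 0 < c ∧
    ∀ (A : Machine) (T : ℕ → ℕ),
      (∀ (n : ℕ) (f : CNF n), (f.length : ℝ) ≤ c * n →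
        A.OutputsWithin (encodeCNF f) [decide (0 < CNF.count f)] (T n)) →
      ∃ᶠ n : ℕ in atTop, (2 : ℝ) ^ ((1 - a) * (n : ℝ)) < (T n : ℝ)

/-! ### Quantum circuits over classical gates and Hadamard gates -/

/-- A gate on `N` qubits: NOT, CNOT, TOFFOLI (the last argument is the target) or Hadamard. -/
inductive Gate (N : ℕ) : Type
  | X (t : Fin N) : Gate N
  | CNOT (c t : Fin N) (hct : c ≠ t) : Gate N
  | TOFFOLI (c d t : Fin N) (hcd : c ≠ d) (hct : c ≠ t) (hdt : d ≠ t) : Gate N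
  | H (t : Fin N) : Gate N

/-- Computational basis labels of `N` qubits. -/
abbrev Bits (N : ℕ) : Type := Fin N → Bool

/-- The permutation matrix of a map of basis labels. -/
def classicalMatrix {N : ℕ} (g : Bits N → Bits N) : Matrix (Bits N) (Bits N) ℂ :=
  Matrix.of fun y x => if y = g x then 1 else 0

/-- The `2 ^ N × 2 ^ N` matrix of a gate, the identity on the qubits it does not mention. -/
noncomputable def Gate.matrix {N : ℕ} : Gate N → Matrix (Bits N) (Bits N) ℂ
  | .X t => classicalMatrix fun x => Function.update x t (!(x t))
  | .CNOT c t _ => classicalMatrix fun x => Function.update x t (xor (x t) (x c))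
  | .TOFFOLI c d t _ _ _ => classicalMatrix fun x => Function.update x t (xor (x t) (x c && x d))
  | .H t => Matrix.of fun y x =>
      if ∀ j, j ≠ t → y j = x j then
        (if x t && y t then -1 else 1) / ((Real.sqrt 2 : ℝ) : ℂ)
      else 0

/-- Is the gate a Hadamard gate? -/
def Gate.isH {N : ℕ} : Gate N → Bool
  | .H _ => true
  | _ => false

/-- A circuit on `N` qubits: the list of its gates, the first one acting first. -/
abbrev Circuit (N : ℕ) : Type := List (Gate N)

/-- The unitary matrix of a circuit. -/
noncomputable def Circuit.matrix {N : ℕ} : Circuit N → Matrix (Bits N) (Bits N) ℂ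
  | [] => 1
  | g :: V => Circuit.matrix V * g.matrix

/-- The number of Hadamard gates of a circuit. -/
def Circuit.numH {N : ℕ} (V : Circuit N) : ℕ := List.countP Gate.isH V

/-- The basis vector `|0^N⟩`. -/
def zeroKet (N : ℕ) : Bits N → ℂ := Pi.single (fun _ => false) 1

/-- The projector `I ⊗ |1⟩⟨1|` onto the value `1` of the last qubit. -/
def lastOneProj (N : ℕ) : Matrix (Bits (N + 1)) (Bits (N + 1)) ℂ :=
  Matrix.diagonal fun x => if x (Fin.last N) = true then 1 else 0

/-- `‖(I ⊗ |1⟩⟨1|) V |0⋯0⟩‖ ^ 2` for a circuit `V` on `N + 1` qubits, in the Euclidean norm. -/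
noncomputable def Circuit.accProb {N : ℕ} (V : Circuit (N + 1)) : ℝ :=
  ‖WithLp.toLp 2 ((lastOneProj N).mulVec ((Circuit.matrix V).mulVec (zeroKet (N + 1))))‖ ^ 2

/-- A gate is written as two bits for its kind, followed by the qubits it acts on, in unary. -/
def encodeGate {N : ℕ} : Gate N → List Bool
  | .X t => [false, false] ++ unary t
  | .CNOT c t _ => [false, true] ++ unary c ++ unary t
  | .TOFFOLI c d t _ _ _ => [true, false] ++ unary c ++ unary d ++ unary t
  | .H t => [true, true] ++ unary t

/-- A circuit is written as its number of qubits followed by the list of its gates. -/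
def encodeCircuit {N : ℕ} (V : Circuit N) : List Bool :=
  unary N ++ encodeList encodeGate V

/-- The real number with the finite binary expansion `b₀.b₁b₂⋯`, given as a list of bits. -/
noncomputable def binaryValue : List Bool → ℝ
  | [] => 0
  | b :: l => (if b = true then 1 else 0) + binaryValue l / 2

/-- On (the description of) the circuit `V`, the machine outputs a finite binary expansion of
exactly `‖(I ⊗ |1⟩⟨1|) V |0⋯0⟩‖ ^ 2` within at most `B` steps. -/
def Machine.ComputesAccProbWithin (A : Machine) {N : ℕ} (V : Circuit (N + 1)) (B : ℝ) : Prop :=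
  ∃ (t : ℕ) (out : List Bool), (t : ℝ) ≤ B ∧ A.OutputsWithin (encodeCircuit V) out t ∧
    binaryValue out = Circuit.accProb V

end FineGrained

/-! Suppose some machine `A` computed the acceptance probabilities in time `2 ^ ((1 - a) h)` for all
large `h`. A formula `f` with `n` variables and at most `d n` clauses is turned into a circuit:
Hadamard gates prepare the uniform superposition of all assignments, classical gates evaluate `f`,
and the value is copied to the last qubit. Classical gates permute basis labels, so ancillas need
not be uncomputed and the acceptance probability is `#f / 2 ^ n` (`accProb_satCircuit`). It is
positive iff `f` is satisfiable, which shows in the output of `A` as the presence of a bit `1`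
(`binaryValue_pos_iff`). Translating, running `A` and scanning its output would thus decide
satisfiability in time `poly(n) + O(2 ^ ((1 - a) n))`, eventually below `2 ^ ((1 - a / 2) n)`,
against SETH for `a / 2`.

SETH as stated bounds the machine at every `n`, while `A` is only assumed good for `h ≥ r`. Hence
`r` redundant Hadamard gates act on qubit `0` after the answer has left it. They do not change the
probability (`lastWeight_H`), and `h = n + r` is never too small. The same number is `#f' / 2 ^ h`
for `f'` equal to `f` with `r` idle variables (`count_pad`). As `r` is a constant, the running time
grows by a constant factor only.

The reduction must be an actual machine. Programs are assembled from fragments with a single exit,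
whose effect on the stacks and time bound are tracked by `Frag.Runs`; `A` itself is one such
fragment (`Frag.runs_simulate`). Qubit `0` holds the conjunction of the clauses seen so far, qubits
`1, …, n` the variables, and the qubits above them are fresh ancillas. The gates can therefore be
emitted in one pass over the formula, with unary counters as the only memory. -/

namespace FineGrained

open Turing Function

/-! ### Program fragments for multi-stack machines -/

/-- Rename the labels of a statement. -/
def relabel {K : Type} {Γ : K → Type} {Λ Λ' σ : Type} (e : Λ → Λ') :
    TM2.Stmt Γ Λ σ → TM2.Stmt Γ Λ' σ
  | .push k f q => .push k f (relabel e q)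
  | .peek k f q => .peek k f (relabel e q)
  | .pop k f q => .pop k f (relabel e q)
  | .load f q => .load f (relabel e q)
  | .branch f q₁ q₂ => .branch f (relabel e q₁) (relabel e q₂)
  | .goto f => .goto fun s => e (f s)
  | .halt => .halt

/-- Labels influence neither the stacks nor the tests, so renaming them commutes with execution. -/
theorem stepAux_relabel {K : Type} [DecidableEq K] {Γ : K → Type} {Λ Λ' σ : Type} (e : Λ → Λ')
    (q : TM2.Stmt Γ Λ σ) (v : σ) (S : ∀ k, List (Γ k)) :
    TM2.stepAux (relabel e q) v S =
      ⟨(TM2.stepAux q v S).l.map e, (TM2.stepAux q v S).var, (TM2.stepAux q v S).stk⟩ := by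
  induction q generalizing v S with
  | branch f q₁ q₂ h₁ h₂ => cases h : f v <;> simp [relabel, h, h₁, h₂]
  | _ => simp_all [relabel]

/-- A program fragment: its code jumps to labels of its own, or leaves through `none`. The first
component of the state is a register that receives popped bits. -/
structure Frag {K : Type} (Γ : K → Type) (τ : Type) where
  /-- the labels -/
  Λ : Type
  [fin : Fintype Λ]
  /-- the first label -/
  entry : Λ
  /-- the code at each label -/
  code : Λ → TM2.Stmt Γ (Option Λ) (Option Bool × τ)

attribute [instance] Frag.fin

namespace Frag

variable {K : Type} [DecidableEq K] {Γ : K → Type} {τ : Type}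

/-- `F.Reach n l v S v' S'`: started at the label `l`, the fragment leaves after `n` steps. -/
inductive Reach (F : Frag Γ τ) : ℕ → F.Λ → Option Bool × τ → (∀ k, List (Γ k)) →
    Option Bool × τ → (∀ k, List (Γ k)) → Prop
  | exit {l v S v' S'} (h : TM2.stepAux (F.code l) v S = ⟨some none, v', S'⟩) :
      Reach F 1 l v S v' S'
  | step {n l v S l₁ v₁ S₁ v' S'} (h : TM2.stepAux (F.code l) v S = ⟨some (some l₁), v₁, S₁⟩)
      (h' : Reach F n l₁ v₁ S₁ v' S') : Reach F (n + 1) l v S v' S'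

/-- How a fragment `F` sits inside a fragment `G`: its labels are renamed by `e`, and its exit is
redirected to `x`. -/
def EmbedsVia (F G : Frag Γ τ) (e : F.Λ → G.Λ) (x : Option G.Λ) : Prop :=
  ∀ l, G.code (e l) = relabel (fun o => o.elim x fun l' => some (e l')) (F.code l)

theorem Reach.embed_exit {F G : Frag Γ τ} {e : F.Λ → G.Λ} (he : F.EmbedsVia G e none)
    {n l v S v' S'} (h : F.Reach n l v S v' S') : G.Reach n (e l) v S v' S' := by
  induction h with
  | exit h => exact .exit (by rw [he, stepAux_relabel, h]; rfl)
  | step h _ ih => exact .step (by rw [he, stepAux_relabel, h]; rfl) ih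

/-- The last step of `F` itself becomes the jump to `x`; composition costs no extra step and times
simply add. -/
theorem Reach.embed_trans {F G : Frag Γ τ} {e : F.Λ → G.Λ} {x : G.Λ}
    (he : F.EmbedsVia G e (some x)) {n l v S v₁ S₁} (h : F.Reach n l v S v₁ S₁)
    {m v' S'} (h' : G.Reach m x v₁ S₁ v' S') : G.Reach (n + m) (e l) v S v' S' := by
  induction h with
  | exit h =>
    rw [Nat.add_comm]
    exact .step (by rw [he, stepAux_relabel, h]; rfl) h'
  | step h _ ih =>
    rw [Nat.add_right_comm]
    exact .step (by rw [he, stepAux_relabel, h]; rfl) (ih h')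

/-- The statement that pushes the symbols `xs` on the stack `k` and leaves. -/
def pushStmt (k : K) : List (Γ k) → TM2.Stmt Γ (Option Unit) (Option Bool × τ)
  | [] => .goto fun _ => none
  | x :: xs => .push k (fun _ => x) (pushStmt k xs)

/-- Push the symbols `xs` on the stack `k`. -/
def push (k : K) (xs : List (Γ k)) : Frag Γ τ where
  Λ := Unit
  entry := ()
  code _ := pushStmt k xs

theorem stepAux_pushStmt (k : K) (xs : List (Γ k)) (v : Option Bool × τ) (S : ∀ k, List (Γ k)) :
    TM2.stepAux (pushStmt k xs) v S = ⟨some none, v, update S k (xs.reverse ++ S k)⟩ := by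
  induction xs generalizing S with
  | nil => simp [pushStmt]
  | cons x xs ih => simp [pushStmt, ih]

variable [Inhabited τ]

/-- The fragment turns the stacks `S` into `S'` within `t` steps. -/
def Runs (F : Frag Γ τ) (S S' : ∀ k, List (Γ k)) (t : ℕ) : Prop :=
  ∀ r : Option Bool, ∃ r' : Option Bool, ∃ n ≤ t,
    F.Reach n F.entry (r, default) S (r', default) S'

theorem Runs.mono {F : Frag Γ τ} {S S' : ∀ k, List (Γ k)} {t t' : ℕ} (h : F.Runs S S' t)
    (ht : t ≤ t') : F.Runs S S' t' := fun r =>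
  let ⟨r', n, hn, hr⟩ := h r
  ⟨r', n, hn.trans ht, hr⟩

/-- Run `F`, then `G`. -/
def seq (F G : Frag Γ τ) : Frag Γ τ where
  Λ := F.Λ ⊕ G.Λ
  entry := .inl F.entry
  code
    | .inl l => relabel (fun o => o.elim (some (.inr G.entry)) fun l' => some (.inl l')) (F.code l)
    | .inr l => relabel (fun o => o.elim none fun l' => some (.inr l')) (G.code l)

theorem Runs.seq {F G : Frag Γ τ} {S S₁ S' : ∀ k, List (Γ k)} {t t' : ℕ} (h : F.Runs S S₁ t)
    (h' : G.Runs S₁ S' t') : (F.seq G).Runs S S' (t + t') := by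
  intro r
  obtain ⟨r₁, n, hn, hF⟩ := h r
  obtain ⟨r', m, hm, hG⟩ := h' r₁
  refine ⟨r', n + m, by omega, ?_⟩
  exact hF.embed_trans (G := F.seq G) (e := Sum.inl) (x := Sum.inr G.entry) (fun _ => rfl)
    (hG.embed_exit (G := F.seq G) (e := Sum.inr) fun _ => rfl)

theorem runs_push (k : K) (xs : List (Γ k)) (S : ∀ k, List (Γ k)) :
    (push (τ := τ) k xs).Runs S (update S k (xs.reverse ++ S k)) 1 := fun r =>
  ⟨r, 1, le_rfl, .exit (stepAux_pushStmt k xs _ S)⟩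

/-- Pop the stack `k` into the register, run the branch which the register selects, and then start
again or leave, again as told by the register. -/
def switch (k : K) (dec : Γ k → Bool) (br : Option Bool → Frag Γ τ) (again : Option Bool → Bool) :
    Frag Γ τ where
  Λ := Option (Σ o : Option Bool, (br o).Λ)
  entry := none
  code
    | none => .pop k (fun s o => (o.map dec, s.2))
        (.goto fun s => some (some ⟨s.1, (br s.1).entry⟩))
    | some ⟨o, l⟩ => relabel (fun x => x.elim (if again o = true then some none else none)
        fun l' => some (some ⟨o, l'⟩)) ((br o).code l)

section switch

variable {k : K} {dec : Γ k → Bool} {br : Option Bool → Frag Γ τ} {again : Option Bool → Bool}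
  {S S₁ S' : ∀ k, List (Γ k)} {o : Option Bool} {t t' : ℕ}

theorem Runs.switch_exit (ho : (S k).head?.map dec = o) (ha : again o = false)
    (h : (br o).Runs (update S k (S k).tail) S' t) :
    (switch k dec br again).Runs S S' (t + 1) := by
  intro r
  obtain ⟨r', n, hn, hF⟩ := h o
  refine ⟨r', n + 1, by omega, .step (l₁ := some ⟨o, (br o).entry⟩) ?_
    (hF.embed_exit (G := switch k dec br again) (e := fun l => some ⟨o, l⟩) fun l => ?_)⟩
  · subst ho; rfl
  · simp [switch, ha]

theorem Runs.switch_again (ho : (S k).head?.map dec = o) (ha : again o = true)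
    (h : (br o).Runs (update S k (S k).tail) S₁ t)
    (h' : (switch k dec br again).Runs S₁ S' t') :
    (switch k dec br again).Runs S S' (t + t' + 1) := by
  intro r
  obtain ⟨r₁, n, hn, hF⟩ := h o
  obtain ⟨r', m, hm, hG⟩ := h' r₁
  refine ⟨r', n + m + 1, by omega, .step (l₁ := some ⟨o, (br o).entry⟩) ?_
    (hF.embed_trans (G := switch k dec br again) (e := fun l => some ⟨o, l⟩) (x := none)
      (fun l => ?_) hG)⟩
  · subst ho; rfl
  · simp [switch, ha]

end switch

/-- Close a fragment to a machine program that halts with clean state at the exit. -/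
def toProgram (F : Frag Γ τ) : Option F.Λ → TM2.Stmt Γ (Option F.Λ) (Option Bool × τ)
  | none => .load (fun _ => (none, default)) .halt
  | some l => F.code l

theorem Reach.iterate_step {F : Frag Γ τ} {n l v S v' S'} (h : F.Reach n l v S v' S') :
    (flip Bind.bind (TM2.step F.toProgram))^[n] (some ⟨some (some l), v, S⟩) =
      some ⟨some none, v', S'⟩ := by
  induction h with
  | exit h => simp [flip, toProgram, h]
  | step h _ ih => rw [iterate_succ_apply]; simpa [flip, toProgram, h] using ih

/-- The additional step resets the register: a halting configuration must carry the initial state.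
-/
theorem Runs.evalsTo {F : Frag Γ τ} {S S' : ∀ k, List (Γ k)} {t : ℕ} (h : F.Runs S S' t) :
    Nonempty (StateTransition.EvalsToInTime (TM2.step F.toProgram)
      ⟨some (some F.entry), (none, default), S⟩ (some ⟨none, (none, default), S'⟩) (t + 1)) := by
  obtain ⟨r', n, hn, hF⟩ := h none
  refine ⟨⟨⟨n + 1, ?_⟩, Nat.succ_le_succ hn⟩⟩
  rw [iterate_succ_apply', hF.iterate_step]
  simp [flip, toProgram]

end Frag

/-! ### Loops, conditionals and subroutine calls -/

namespace Frag

section loop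

variable {K : Type} [DecidableEq K] {Γ : K → Type} {τ : Type} [Inhabited τ]

/-- Do nothing. -/
def skip : Frag Γ τ where
  Λ := Unit
  entry := ()
  code _ := .goto fun _ => none

theorem runs_skip (S : ∀ k, List (Γ k)) : (skip (τ := τ)).Runs S S 1 := fun r =>
  ⟨r, 1, le_rfl, .exit rfl⟩

theorem Runs.to {F : Frag Γ τ} {S S₁ S' : ∀ k, List (Γ k)} {t t' : ℕ} (h : F.Runs S S₁ t)
    (hS : S₁ = S') (ht : t ≤ t' := by omega) : F.Runs S S' t' :=
  hS ▸ h.mono ht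

/-- Pop the stack `k` until it is empty, running `body b` for each popped symbol with code `b`, and
finally run `last`. -/
def loop (k : K) (dec : Γ k → Bool) (body : Bool → Frag Γ τ) (last : Frag Γ τ) : Frag Γ τ :=
  switch k dec (fun o => o.elim last body) Option.isSome

/-- Pop the stack `k` until something else than a code of `true` is found, running `body` each
time. -/
def repeatWhile (k : K) (dec : Γ k → Bool) (body last : Frag Γ τ) : Frag Γ τ :=
  switch k dec (fun o => if o = some true then body else last) fun o => o = some true

/-- Pop the stack `k` and run `F` if this gives a code of `true`, and `G` otherwise. -/
def ite (k : K) (dec : Γ k → Bool) (F G : Frag Γ τ) : Frag Γ τ :=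
  switch k dec (fun o => if o = some true then F else G) fun _ => false

variable {k : K} {dec : Γ k → Bool} {S S₁ S' : ∀ k, List (Γ k)} {t t' : ℕ} {x : Γ k}
  {xs : List (Γ k)}

theorem Runs.loop_nil {body : Bool → Frag Γ τ} {last : Frag Γ τ} (hk : S k = [])
    (h : last.Runs S S' t) : (loop k dec body last).Runs S S' (t + 1) := by
  refine Runs.switch_exit (o := none) (by simp [hk]) rfl ?_
  have : update S k (S k).tail = S := by rw [hk, List.tail_nil, ← hk, update_eq_self]
  simpa [this] using h

theorem Runs.loop_cons {body : Bool → Frag Γ τ} {last : Frag Γ τ} (hk : S k = x :: xs)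
    (h : (body (dec x)).Runs (update S k xs) S₁ t) (h' : (loop k dec body last).Runs S₁ S' t') :
    (loop k dec body last).Runs S S' (t + t' + 1) :=
  Runs.switch_again (o := some (dec x)) (by simp [hk]) rfl (by simpa [hk] using h) h'

theorem Runs.while_false {body last : Frag Γ τ} (hk : S k = x :: xs) (hx : dec x = false)
    (h : last.Runs (update S k xs) S' t) : (repeatWhile k dec body last).Runs S S' (t + 1) :=
  Runs.switch_exit (o := some false) (by simp [hk, hx]) rfl (by simpa [hk] using h)

theorem Runs.while_true {body last : Frag Γ τ} (hk : S k = x :: xs) (hx : dec x = true)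
    (h : body.Runs (update S k xs) S₁ t) (h' : (repeatWhile k dec body last).Runs S₁ S' t') :
    (repeatWhile k dec body last).Runs S S' (t + t' + 1) :=
  Runs.switch_again (o := some true) (by simp [hk, hx]) rfl (by simpa [hk] using h) h'

theorem Runs.ite_nil {F G : Frag Γ τ} (hk : S k = []) (h : G.Runs S S' t) :
    (ite k dec F G).Runs S S' (t + 1) := by
  refine Runs.switch_exit (o := none) (by simp [hk]) rfl ?_
  have : update S k (S k).tail = S := by rw [hk, List.tail_nil, ← hk, update_eq_self]
  simpa [this] using h

theorem Runs.ite_false {F G : Frag Γ τ} (hk : S k = x :: xs) (hx : dec x = false)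
    (h : G.Runs (update S k xs) S' t) : (ite k dec F G).Runs S S' (t + 1) :=
  Runs.switch_exit (o := some false) (by simp [hk, hx]) rfl (by simpa [hk] using h)

theorem Runs.ite_true {F G : Frag Γ τ} (hk : S k = x :: xs) (hx : dec x = true)
    (h : F.Runs (update S k xs) S' t) : (ite k dec F G).Runs S S' (t + 1) :=
  Runs.switch_exit (o := some true) (by simp [hk, hx]) rfl (by simpa [hk] using h)

end loop

/-! ### A machine as a subroutine -/

section simulate

variable {C : Type} [DecidableEq C] {tm : FinTM2}

/-- The stack alphabets of a program that owns a Bool-valued stack for each element of `C`, and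
uses the stacks of `tm`. -/
abbrev Alph (C : Type) (tm : FinTM2) : C ⊕ tm.K → Type
  | .inl _ => Bool
  | .inr k => tm.Γ k

/-- The own stacks `O` together with the stacks `R` of `tm`. -/
def join (O : C → List Bool) (R : ∀ k, List (tm.Γ k)) : ∀ k, List (Alph C tm k)
  | .inl c => O c
  | .inr k => R k

theorem update_join_inl (O : C → List Bool) (R : ∀ k, List (tm.Γ k)) (c : C) (x : List Bool) :
    update (join O R) (.inl c) x = join (update O c x) R := by
  funext k
  rcases k with d | k
  · by_cases h : d = c
    · subst h; simp [join]
    · simp [join, h]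
  · simp [join]

theorem update_join_inr (O : C → List Bool) (R : ∀ k, List (tm.Γ k)) (k : tm.K)
    (x : List (tm.Γ k)) : update (join O R) (.inr k) x = join O (update R k x) := by
  funext j
  rcases j with d | j
  · simp [join]
  · by_cases h : j = k
    · subst h; simp [join]
    · simp [join, h]

/-- The statements of `tm` as statements of a program with own stacks `C`. -/
def embedStmt (C : Type) (tm : FinTM2) : TM2.Stmt tm.Γ tm.Λ tm.σ →
    TM2.Stmt (Alph C tm) (Option tm.Λ) (Option Bool × tm.σ)
  | .push k f q => .push (.inr k) (fun s => f s.2) (embedStmt C tm q)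
  | .peek k f q => .peek (.inr k) (fun s o => (s.1, f s.2 o)) (embedStmt C tm q)
  | .pop k f q => .pop (.inr k) (fun s o => (s.1, f s.2 o)) (embedStmt C tm q)
  | .load f q => .load (fun s => (s.1, f s.2)) (embedStmt C tm q)
  | .branch f q₁ q₂ => .branch (fun s => f s.2) (embedStmt C tm q₁) (embedStmt C tm q₂)
  | .goto f => .goto fun s => some (f s.2)
  | .halt => .goto fun _ => none

theorem stepAux_embedStmt (q : TM2.Stmt tm.Γ tm.Λ tm.σ) (r : Option Bool) (v : tm.σ)
    (O : C → List Bool) (R : ∀ k, List (tm.Γ k)) :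
    TM2.stepAux (embedStmt C tm q) (r, v) (join O R) =
      ⟨some (TM2.stepAux q v R).l, (r, (TM2.stepAux q v R).var),
        join O (TM2.stepAux q v R).stk⟩ := by
  induction q generalizing v R with
  | branch f q₁ q₂ h₁ h₂ => cases h : f v <;> simp [embedStmt, h, h₁, h₂]
  | push k f q ih => simp only [embedStmt, TM2.stepAux]; rw [update_join_inr, ← ih]; rfl
  | pop k f q ih => simp only [embedStmt, TM2.stepAux]; rw [update_join_inr, ← ih]; rfl
  | peek k f q ih => simp only [embedStmt, TM2.stepAux]; rw [← ih]; rfl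
  | load f q ih => simp only [embedStmt, TM2.stepAux]; rw [← ih]
  | goto f => rfl
  | halt => rfl

/-- The machine `tm` as a subroutine. -/
def simulate (C : Type) (tm : FinTM2) : Frag (Alph C tm) tm.σ where
  Λ := tm.Λ
  fin := tm.ΛFin
  entry := tm.main
  code l := embedStmt C tm (tm.m l)

theorem iterate_bind_none {α : Type*} (f : α → Option α) (n : ℕ) :
    (flip Bind.bind f)^[n] none = none := by
  induction n with
  | zero => rfl
  | succ n ih => rw [iterate_succ_apply]; simpa [flip] using ih

/-- Halting in `tm` becomes leaving the fragment, so the simulation proceeds step for step without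
overhead. -/
theorem reach_simulate (r : Option Bool) (O : C → List Bool) {n : ℕ} {l : tm.Λ} {v v' : tm.σ}
    {R R' : ∀ k, List (tm.Γ k)}
    (h : (flip Bind.bind (TM2.step tm.m))^[n] (some ⟨some l, v, R⟩) = some ⟨none, v', R'⟩) :
    (simulate C tm).Reach n l (r, v) (join O R) (r, v') (join O R') := by
  induction n generalizing l v R with
  | zero => simp at h
  | succ n ih =>
    rw [iterate_succ_apply] at h
    have hs := stepAux_embedStmt (tm.m l) r v O R
    simp only [flip, Option.bind_eq_bind, Option.bind_some, TM2.step] at h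
    rcases hc : TM2.stepAux (tm.m l) v R with ⟨_ | l₁, v₁, R₁⟩
    · rw [hc] at h hs
      -- A halted configuration has no successor, so no iteration may remain.
      have hn : n = 0 := by
        rcases n with _ | n
        · rfl
        · rw [iterate_succ_apply] at h
          have := (iterate_bind_none (TM2.step tm.m) n).symm.trans h
          simp at this
      subst hn
      obtain ⟨rfl, rfl⟩ : v₁ = v' ∧ R₁ = R' := by simpa using h
      exact .exit hs
    · rw [hc] at h hs
      exact .step hs (ih h)

theorem initList_eq (s : List (tm.Γ tm.k₀)) :
    initList tm s = ⟨some tm.main, tm.initialState, update (fun _ => []) tm.k₀ s⟩ := by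
  unfold initList
  congr 1
  funext k
  by_cases h : k = tm.k₀
  · subst h; simp
  · simp [h]

theorem haltList_eq (s : List (tm.Γ tm.k₁)) :
    haltList tm s = ⟨none, tm.initialState, update (fun _ => []) tm.k₁ s⟩ := by
  unfold haltList
  congr 1
  funext k
  by_cases h : k = tm.k₁
  · subst h; simp
  · simp [h]

/-- By convention a machine halts in its initial state with all stacks but the output empty. This is
what lets it return to the calling program in a known configuration. -/
theorem runs_simulate {s : List (tm.Γ tm.k₀)} {s' : List (tm.Γ tm.k₁)} {t : ℕ}
    (h : Nonempty (TM2OutputsInTime tm s (some s') t)) (O : C → List Bool) :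
    (simulate C tm).Runs (join O (update (fun _ => []) tm.k₀ s))
      (join O (update (fun _ => []) tm.k₁ s')) t := by
  intro r
  obtain ⟨⟨⟨n, hn⟩, hnt⟩⟩ := h
  refine ⟨r, n, hnt, ?_⟩
  rw [Option.map_some, initList_eq, haltList_eq] at hn
  exact reach_simulate r O hn

end simulate

end Frag

/-! ### Growth of the stacks -/

/-- A bound for the number of symbols that a statement pushes. -/
def pushBound {K : Type} {Γ : K → Type} {Λ σ : Type} : TM2.Stmt Γ Λ σ → ℕ
  | .push _ _ q => pushBound q + 1
  | .peek _ _ q => pushBound q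
  | .pop _ _ q => pushBound q
  | .load _ q => pushBound q
  | .branch _ q₁ q₂ => pushBound q₁ + pushBound q₂
  | .goto _ => 0
  | .halt => 0

theorem length_stk_stepAux_le {K : Type} [DecidableEq K] {Γ : K → Type} {Λ σ : Type}
    (q : TM2.Stmt Γ Λ σ) (v : σ) (S : ∀ k, List (Γ k)) (k : K) :
    ((TM2.stepAux q v S).stk k).length ≤ (S k).length + pushBound q := by
  induction q generalizing v S with
  | push j f q ih =>
    refine (ih _ _).trans ?_
    by_cases h : k = j
    · subst h; simp [pushBound]; omega
    · simp [pushBound, h]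
  | pop j f q ih =>
    refine (ih _ _).trans ?_
    by_cases h : k = j
    · subst h; simp [pushBound]
    · simp [pushBound, h]
  | peek j f q ih => exact ih _ _
  | load f q ih => exact ih _ _
  | branch f q₁ q₂ h₁ h₂ =>
    have := h₁ v S
    have := h₂ v S
    cases h : f v <;> simp only [TM2.stepAux, h, cond, pushBound] <;> omega
  | goto f => simp [pushBound]
  | halt => simp [pushBound]

/-- One step executes a whole statement and may push several symbols, but boundedly many since there
are finitely many labels. Reading the output of `A` therefore costs at most a constant times the
running time of `A`, plus the input length. -/
theorem exists_length_output_le (tm : FinTM2) : ∃ B : ℕ, ∀ (s : List (tm.Γ tm.k₀))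
    (s' : List (tm.Γ tm.k₁)) (t : ℕ), Nonempty (TM2OutputsInTime tm s (some s') t) →
      s'.length ≤ s.length + B * t := by
  have := tm.ΛFin
  refine ⟨∑ l, pushBound (tm.m l), fun s s' t h => ?_⟩
  set B := ∑ l, pushBound (tm.m l) with hB
  have key : ∀ (n : ℕ) (c c' : tm.Cfg) (k : tm.K),
      (flip Bind.bind tm.step)^[n] (some c) = some c' →
        (c'.stk k).length ≤ (c.stk k).length + B * n := by
    intro n
    induction n with
    | zero => intro c c' k h; obtain rfl : c = c' := by simpa using h
              simp
    | succ n ih =>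
      intro c c' k h
      rw [iterate_succ_apply] at h
      rcases c with ⟨_ | l, v, S⟩
      · have := (Frag.iterate_bind_none (TM2.step tm.m) n).symm.trans h
        simp at this
      · refine (ih (TM2.stepAux (tm.m l) v S) c' k h).trans ?_
        have h₁ := length_stk_stepAux_le (tm.m l) v S k
        have h₂ : pushBound (tm.m l) ≤ B :=
          Finset.single_le_sum (f := fun l => pushBound (tm.m l)) (fun _ _ => Nat.zero_le _)
            (Finset.mem_univ l)
        have : (S k).length = (TM2.Cfg.stk (⟨some l, v, S⟩ : tm.Cfg) k).length := rfl
        rw [mul_add, mul_one]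
        omega
  obtain ⟨⟨⟨n, hn⟩, hnt⟩⟩ := h
  have h := key n _ _ tm.k₁ hn
  rw [Frag.initList_eq, Frag.haltList_eq] at h
  -- The input and output stacks may coincide, so the input can already lie on the output stack at
  -- the start.
  have hs : ((update (fun _ => []) tm.k₀ s : ∀ k, List (tm.Γ k)) tm.k₁).length ≤ s.length := by
    by_cases e : tm.k₁ = tm.k₀
    · have : ∀ k, ((update (fun _ => []) tm.k₀ s : ∀ k, List (tm.Γ k)) k).length ≤ s.length := by
        intro k
        by_cases e : k = tm.k₀
        · subst e; simp
        · simp [e]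
      exact this _
    · simp [e]
  simp only [update_self] at h
  exact h.trans (Nat.add_le_add hs (Nat.mul_le_mul_left _ hnt))

/-! ### Circuits with qubits numbered by naturals -/

@[simp] theorem unary_zero : unary 0 = [false] := rfl

theorem unary_succ (n : ℕ) : unary (n + 1) = true :: unary n := rfl

/-- A gate whose qubits are numbered by arbitrary naturals. -/
inductive NatGate : Type
  | X (t : ℕ)
  | CNOT (c t : ℕ)
  | TOFFOLI (c d t : ℕ)
  | H (t : ℕ)

namespace NatGate

/-- The code of a gate, as in `encodeGate`. -/
def code : NatGate → List Bool
  | X t => [false, false] ++ unary t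
  | CNOT c t => [false, true] ++ unary c ++ unary t
  | TOFFOLI c d t => [true, false] ++ unary c ++ unary d ++ unary t
  | H t => [true, true] ++ unary t

end NatGate

/-- The entries of the code of a gate list, without the end mark. -/
def codeGates (l : List NatGate) : List Bool :=
  l.flatMap fun g => true :: g.code

@[simp] theorem codeGates_nil : codeGates [] = [] := rfl

@[simp] theorem codeGates_cons (g : NatGate) (l : List NatGate) :
    codeGates (g :: l) = true :: (g.code ++ codeGates l) := rfl

@[simp] theorem codeGates_append (l l' : List NatGate) :
    codeGates (l ++ l') = codeGates l ++ codeGates l' := List.flatMap_append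

/-- A clause as the list of the occurrences of the literals `(i, true)` and `(i, false)`, by
increasing `i`. -/
abbrev BitClause : Type := List (Bool × Bool)

/-- The code of a clause, as in `encodeClause`. -/
def codeClause (l : BitClause) : List Bool :=
  l.flatMap fun p => [p.1, p.2]

/-- Number of literals of a clause. -/
def width : BitClause → ℕ
  | [] => 0
  | (p, q) :: l => p.toNat + q.toNat + width l

/-- Toggle qubit `i` and, if `b`, put the conjunction of qubits `i` and `f` into qubit `f + 1`. -/
def bitGates (i f : ℕ) (b : Bool) : List NatGate :=
  .X i :: if b = true then [.TOFFOLI i f (f + 1)] else []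

/-- Starting from qubit `f`, compute the conjunction with the negations of the literals of a list of
variables that begins with variable `i`. -/
def varsGates : ℕ → ℕ → BitClause → List NatGate
  | _, _, [] => []
  | i, f, (p, q) :: l =>
    bitGates (i + 1) f p ++ (bitGates (i + 1) (f + p.toNat) q ++
      varsGates (i + 1) (f + p.toNat + q.toNat) l)

/-- Replace qubit `0` by its conjunction with a clause; `f` is the first fresh qubit. -/
def clauseGates (f : ℕ) (l : BitClause) : List NatGate :=
  .CNOT 0 f :: (varsGates 0 f l ++ [.CNOT (f + width l) 0])

/-- Replace qubit `0` by its conjunction with a list of clauses. -/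
def formulaGates : ℕ → List BitClause → List NatGate
  | _, [] => []
  | f, l :: ls => clauseGates f l ++ formulaGates (f + width l + 1) ls

/-- The number of ancillas that `formulaGates` uses. -/
def ancillas : List BitClause → ℕ
  | [] => 0
  | l :: ls => width l + 1 + ancillas ls

/-- Hadamard gates on the `k` qubits after qubit `i`. -/
def hadamards (i k : ℕ) : List NatGate :=
  (List.range' (i + 1) k).map .H

/-- The index of the last qubit in the circuit of a formula. -/
def lastQubit (n : ℕ) (ls : List BitClause) : ℕ := n + 1 + ancillas ls

/-- The circuit that evaluates a formula on a uniform superposition, with `r` redundant Hadamard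
gates at the end. -/
def satGates (n : ℕ) (ls : List BitClause) (r : ℕ) : List NatGate :=
  hadamards 0 n ++ (.X 0 :: (formulaGates (n + 1) ls ++
    (.CNOT 0 (lastQubit n ls) :: List.replicate r (.H 0))))

/-- The code of the circuit `satGates`. -/
def satCode (n : ℕ) (ls : List BitClause) (r : ℕ) : List Bool :=
  unary (lastQubit n ls + 1) ++ (codeGates (satGates n ls r) ++ [false])

/-! ### Size of the circuit and validity of its gates -/

theorem width_le (l : BitClause) : width l ≤ 2 * l.length := by
  induction l with
  | nil => simp [width]
  | cons p l ih =>
    have := Bool.toNat_le p.1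
    have := Bool.toNat_le p.2
    simp only [width, List.length_cons]
    omega

theorem ancillas_le {n : ℕ} {ls : List BitClause} (h : ∀ l ∈ ls, l.length = n) :
    ancillas ls ≤ ls.length * (2 * n + 1) := by
  induction ls with
  | nil => simp [ancillas]
  | cons l ls ih =>
    have h₁ := width_le l
    have h₂ := ih fun l hl => h l (List.mem_cons_of_mem _ hl)
    rw [h l List.mem_cons_self] at h₁
    simp only [ancillas, List.length_cons, add_mul, one_mul]
    omega

theorem length_varsGates_le (i f : ℕ) (l : BitClause) :
    (varsGates i f l).length ≤ 4 * l.length := by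
  induction l generalizing i f with
  | nil => simp [varsGates]
  | cons p l ih =>
    have h (b : Bool) (i f : ℕ) : (bitGates i f b).length ≤ 2 := by cases b <;> simp [bitGates]
    have h₁ := h p.1 (i + 1) f
    have h₂ := h p.2 (i + 1) (f + p.1.toNat)
    have h₃ := ih (i + 1) (f + p.1.toNat + p.2.toNat)
    simp only [varsGates, List.length_append, List.length_cons]
    omega

theorem length_formulaGates_le {n : ℕ} {ls : List BitClause} (h : ∀ l ∈ ls, l.length = n)
    (f : ℕ) : (formulaGates f ls).length ≤ ls.length * (4 * n + 2) := by
  induction ls generalizing f with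
  | nil => simp [formulaGates]
  | cons l ls ih =>
    have h₁ := length_varsGates_le 0 f l
    have h₂ := ih (fun l hl => h l (List.mem_cons_of_mem _ hl)) (f + width l + 1)
    rw [h l List.mem_cons_self] at h₁
    simp only [formulaGates, clauseGates, List.length_append, List.length_cons, List.length_nil,
      add_mul, one_mul]
    omega

theorem length_satGates_le {n : ℕ} {ls : List BitClause} (h : ∀ l ∈ ls, l.length = n) (r : ℕ) :
    (satGates n ls r).length ≤ n + ls.length * (4 * n + 2) + 2 + r := by
  have := length_formulaGates_le h (n + 1)
  simp only [satGates, hadamards, List.length_append, List.length_cons, List.length_map,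
    List.length_range', List.length_replicate]
  omega

namespace NatGate

/-- The gate acts on distinct qubits below `N`. -/
def Valid (N : ℕ) : NatGate → Prop
  | X t => t < N
  | CNOT c t => c < N ∧ t < N ∧ c ≠ t
  | TOFFOLI c d t => c < N ∧ d < N ∧ t < N ∧ c ≠ d ∧ c ≠ t ∧ d ≠ t
  | H t => t < N

theorem length_code_le {N : ℕ} {g : NatGate} (h : g.Valid N) : g.code.length ≤ 3 * N + 2 := by
  cases g <;> simp only [Valid] at h <;> simp [code, unary] <;> omega

end NatGate

theorem length_codeGates_le {N : ℕ} {l : List NatGate} (h : ∀ g ∈ l, g.Valid N) :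
    (codeGates l).length ≤ l.length * (3 * N + 3) := by
  induction l with
  | nil => simp
  | cons g l ih =>
    have h₁ := NatGate.length_code_le (h g List.mem_cons_self)
    have h₂ := ih fun g hg => h g (List.mem_cons_of_mem _ hg)
    simp only [codeGates_cons, List.length_cons, List.length_append, add_mul, one_mul]
    omega

theorem valid_bitGates {N i f : ℕ} (b : Bool) (hi : i < f) (hf : f + b.toNat < N) :
    ∀ g ∈ bitGates i f b, g.Valid N := by
  cases b <;> simp [bitGates, NatGate.Valid] at * <;> omega

/-- The hypothesis `hi` keeps the variables strictly below the qubits that carry the running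
conjunction, which makes the qubits of every TOFFOLI distinct. -/
theorem valid_varsGates {N i f : ℕ} {l : BitClause} (hi : i + l.length < f)
    (hf : f + width l < N) : ∀ g ∈ varsGates i f l, g.Valid N := by
  induction l generalizing i f with
  | nil => simp [varsGates]
  | cons p l ih =>
    simp only [width, List.length_cons] at hi hf
    intro g hg
    simp only [varsGates, List.mem_append] at hg
    rcases hg with hg | hg | hg
    · exact valid_bitGates _ (by omega) (by omega) g hg
    · exact valid_bitGates _ (by omega) (by omega) g hg
    · exact ih (by omega) (by omega) g hg

theorem valid_formulaGates {N n f : ℕ} {ls : List BitClause} (h : ∀ l ∈ ls, l.length = n)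
    (hn : n < f) (hf : f + ancillas ls ≤ N) : ∀ g ∈ formulaGates f ls, g.Valid N := by
  induction ls generalizing f with
  | nil => simp [formulaGates]
  | cons l ls ih =>
    simp only [ancillas] at hf
    have hl := h l List.mem_cons_self
    intro g hg
    simp only [formulaGates, clauseGates, List.mem_append, List.mem_cons, List.not_mem_nil,
      or_false] at hg
    rcases hg with (rfl | hg | rfl) | hg
    · simp only [NatGate.Valid]; omega
    · exact valid_varsGates (by omega) (by omega) g hg
    · simp only [NatGate.Valid]; omega
    · exact ih (fun l hl => h l (List.mem_cons_of_mem _ hl)) (by omega) (by omega) g hg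

theorem valid_satGates {n : ℕ} {ls : List BitClause} (h : ∀ l ∈ ls, l.length = n) (r : ℕ) :
    ∀ g ∈ satGates n ls r, g.Valid (lastQubit n ls + 1) := by
  intro g hg
  simp only [satGates, hadamards, List.mem_append, List.mem_cons, List.mem_map,
    List.mem_range'_1, List.mem_replicate] at hg
  rcases hg with ⟨i, hi, rfl⟩ | rfl | hg | rfl | ⟨-, rfl⟩
  · simp only [NatGate.Valid, lastQubit]; omega
  · simp only [NatGate.Valid, lastQubit]; omega
  · exact valid_formulaGates h (by omega) (by simp only [lastQubit]; omega) g hg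
  · simp only [NatGate.Valid, lastQubit]; omega
  · simp only [NatGate.Valid, lastQubit]; omega

/-! ### A program that translates formulas to circuits -/

/-- The own stacks of the translating program: the input, the emitted code (reversed), the index of
the current variable, the number of remaining variables, the first fresh qubit, and a scratch
counter. -/
inductive Own : Type
  | inp | out | i | j | f | s
  deriving DecidableEq

instance : Fintype Own where
  elems := {.inp, .out, .i, .j, .f, .s}
  complete c := by cases c <;> decide

/-- Contents of the own stacks. -/
def own (inp out : List Bool) (i j f s : ℕ) : Own → List Bool
  | .inp => inp
  | .out => out.reverse
  | .i => List.replicate i true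
  | .j => List.replicate j true
  | .f => List.replicate f true
  | .s => List.replicate s true

section update

variable (inp out : List Bool) (i j f s : ℕ)

theorem update_own_inp (x : List Bool) :
    update (own inp out i j f s) .inp x = own x out i j f s := by
  funext c; cases c <;> simp [own]

theorem update_own_out (x : List Bool) :
    update (own inp out i j f s) .out x = own inp x.reverse i j f s := by
  funext c; cases c <;> simp [own]

theorem update_own_i (n : ℕ) :
    update (own inp out i j f s) .i (List.replicate n true) = own inp out n j f s := by
  funext c; cases c <;> simp [own]

theorem update_own_j (n : ℕ) :
    update (own inp out i j f s) .j (List.replicate n true) = own inp out i n f s := by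
  funext c; cases c <;> simp [own]

theorem update_own_f (n : ℕ) :
    update (own inp out i j f s) .f (List.replicate n true) = own inp out i j n s := by
  funext c; cases c <;> simp [own]

theorem update_own_s (n : ℕ) :
    update (own inp out i j f s) .s (List.replicate n true) = own inp out i j f n := by
  funext c; cases c <;> simp [own]

end update

namespace Frag

variable {tm : FinTM2}

/-- Program fragments with the stacks `Own` and those of `tm`. -/
abbrev Prog (tm : FinTM2) : Type 1 := Frag (Alph Own tm) tm.σ

/-- Emit bits. -/
def put (w : List Bool) : Prog tm := push (.inl .out) w

/-- Increment a counter. -/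
def inc (c : Own) : Prog tm := push (.inl c) [true]

/-- Emit the unary code of a counter. -/
def emit (c : Own) : Prog tm :=
  (loop (.inl c) id (fun _ => (put [true]).seq (inc .s)) (put [false])).seq
    (loop (.inl .s) id (fun _ => inc c) skip)

variable {R : ∀ k, List (tm.Γ k)} {inp out : List Bool} {i j f s t t' : ℕ}
  {S₁ S' : ∀ k, List (Alph Own tm k)}

theorem runs_put (w : List Bool) : (put w).Runs (join (own inp out i j f s) R)
    (join (own inp (out ++ w) i j f s) R) 1 := by
  refine (runs_push _ _ _).to ?_
  rw [update_join_inl]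
  exact congrArg (join · R) ((update_own_out inp out i j f s (w.reverse ++ out.reverse)).trans
    (by simp))

theorem runs_inc_i : (inc .i).Runs (join (own inp out i j f s) R)
    (join (own inp out (i + 1) j f s) R) 1 := by
  refine (runs_push _ _ _).to ?_
  rw [update_join_inl]
  exact congrArg (join · R) (update_own_i inp out i j f s (i + 1))

theorem runs_inc_j : (inc .j).Runs (join (own inp out i j f s) R)
    (join (own inp out i (j + 1) f s) R) 1 := by
  refine (runs_push _ _ _).to ?_
  rw [update_join_inl]
  exact congrArg (join · R) (update_own_j inp out i j f s (j + 1))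

theorem runs_inc_f : (inc .f).Runs (join (own inp out i j f s) R)
    (join (own inp out i j (f + 1) s) R) 1 := by
  refine (runs_push _ _ _).to ?_
  rw [update_join_inl]
  exact congrArg (join · R) (update_own_f inp out i j f s (f + 1))

theorem runs_inc_s : (inc .s).Runs (join (own inp out i j f s) R)
    (join (own inp out i j f (s + 1)) R) 1 := by
  refine (runs_push _ _ _).to ?_
  rw [update_join_inl]
  exact congrArg (join · R) (update_own_s inp out i j f s (s + 1))

section loops

variable {body : Bool → Prog tm} {last : Prog tm}

theorem Runs.loop_i (h : (body true).Runs (join (own inp out i j f s) R) S₁ t)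
    (h' : (loop (.inl .i) id body last).Runs S₁ S' t') :
    (loop (.inl .i) id body last).Runs (join (own inp out (i + 1) j f s) R) S' (t + t' + 1) := by
  refine Runs.loop_cons (x := true) (xs := List.replicate i true) rfl ?_ h'
  rw [update_join_inl, update_own_i]
  exact h

theorem Runs.loop_j (h : (body true).Runs (join (own inp out i j f s) R) S₁ t)
    (h' : (loop (.inl .j) id body last).Runs S₁ S' t') :
    (loop (.inl .j) id body last).Runs (join (own inp out i (j + 1) f s) R) S' (t + t' + 1) := by
  refine Runs.loop_cons (x := true) (xs := List.replicate j true) rfl ?_ h'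
  rw [update_join_inl, update_own_j]
  exact h

theorem Runs.loop_f (h : (body true).Runs (join (own inp out i j f s) R) S₁ t)
    (h' : (loop (.inl .f) id body last).Runs S₁ S' t') :
    (loop (.inl .f) id body last).Runs (join (own inp out i j (f + 1) s) R) S' (t + t' + 1) := by
  refine Runs.loop_cons (x := true) (xs := List.replicate f true) rfl ?_ h'
  rw [update_join_inl, update_own_f]
  exact h

theorem Runs.loop_s (h : (body true).Runs (join (own inp out i j f s) R) S₁ t)
    (h' : (loop (.inl .s) id body last).Runs S₁ S' t') :
    (loop (.inl .s) id body last).Runs (join (own inp out i j f (s + 1)) R) S' (t + t' + 1) := by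
  refine Runs.loop_cons (x := true) (xs := List.replicate s true) rfl ?_ h'
  rw [update_join_inl, update_own_s]
  exact h

end loops

/-- Reading a unary counter destroys it, so it is moved to the scratch counter while being emitted
(three steps per unit) and then moved back (two steps per unit). -/
theorem runs_emit_i : (emit .i).Runs (join (own inp out i j f 0) R)
    (join (own inp (out ++ unary i) i j f 0) R) (5 * i + 4) := by
  have h₁ : ∀ (i s : ℕ) (out : List Bool),
      (loop (.inl .i) id (fun _ => (put [true]).seq (inc .s)) (put [false])).Runs
        (join (own inp out i j f s) R) (join (own inp (out ++ unary i) 0 j f (s + i)) R)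
        (3 * i + 2) := by
    intro i
    induction i with
    | zero => exact fun s out => (Runs.loop_nil rfl (runs_put [false])).to rfl
    | succ i ih =>
      intro s out
      refine (Runs.loop_i ((runs_put [true]).seq runs_inc_s) (ih _ _)).to ?_
      rw [unary_succ, List.append_assoc, List.singleton_append, Nat.add_right_comm, Nat.add_assoc]
  have h₂ : ∀ (s i : ℕ) (out : List Bool),
      (loop (.inl .s) id (fun _ => inc .i) skip).Runs
        (join (own inp out i j f s) R) (join (own inp out (i + s) j f 0) R) (2 * s + 2) := by
    intro s
    induction s with
    | zero => exact fun s out => (Runs.loop_nil rfl (runs_skip _)).to rfl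
    | succ s ih =>
      intro i out
      refine (Runs.loop_s runs_inc_i (ih _ _)).to ?_
      rw [Nat.add_right_comm, Nat.add_assoc]
  refine ((h₁ i 0 out).seq (h₂ (0 + i) 0 _)).to ?_
  simp only [Nat.zero_add]

theorem runs_emit_f : (emit .f).Runs (join (own inp out i j f 0) R)
    (join (own inp (out ++ unary f) i j f 0) R) (5 * f + 4) := by
  have h₁ : ∀ (f s : ℕ) (out : List Bool),
      (loop (.inl .f) id (fun _ => (put [true]).seq (inc .s)) (put [false])).Runs
        (join (own inp out i j f s) R) (join (own inp (out ++ unary f) i j 0 (s + f)) R)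
        (3 * f + 2) := by
    intro f
    induction f with
    | zero => exact fun s out => (Runs.loop_nil rfl (runs_put [false])).to rfl
    | succ f ih =>
      intro s out
      refine (Runs.loop_f ((runs_put [true]).seq runs_inc_s) (ih _ _)).to ?_
      rw [unary_succ, List.append_assoc, List.singleton_append, Nat.add_right_comm, Nat.add_assoc]
  have h₂ : ∀ (s f : ℕ) (out : List Bool),
      (loop (.inl .s) id (fun _ => inc .f) skip).Runs
        (join (own inp out i j f s) R) (join (own inp out i j (f + s) 0) R) (2 * s + 2) := by
    intro s
    induction s with
    | zero => exact fun s out => (Runs.loop_nil rfl (runs_skip _)).to rfl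
    | succ s ih =>
      intro f out
      refine (Runs.loop_s runs_inc_f (ih _ _)).to ?_
      rw [Nat.add_right_comm, Nat.add_assoc]
  refine ((h₁ f 0 out).seq (h₂ (0 + f) 0 _)).to ?_
  simp only [Nat.zero_add]

/-- Read the number of variables, emitting their Hadamard gates. -/
def readVars : Prog tm :=
  repeatWhile (.inl .inp) id
    ((inc .f).seq ((inc .i).seq ((put [true, true, true]).seq (emit .i)))) skip

theorem runs_readVars (k : ℕ) {M : ℕ} (hM : i + k ≤ M) :
    readVars.Runs (join (own (unary k ++ inp) out i j f 0) R)
      (join (own inp (out ++ codeGates (hadamards i k)) (i + k) j (f + k) 0) R)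
      (k * (5 * M + 8) + 2) := by
  induction k generalizing i f out with
  | zero =>
    refine (Runs.while_false (x := false) (xs := inp) rfl rfl (runs_skip _)).to ?_
    rw [update_join_inl, update_own_inp]
    simp [hadamards]
  | succ k ih =>
    have h := ih (i := i + 1) (f := f + 1) (out := out ++ [true, true, true] ++ unary (i + 1))
      (by omega)
    -- Three pushes, and `5 * (i + 1) + 4` steps to emit the incremented counter.
    refine (Runs.while_true (t := 5 * i + 12) (x := true) (xs := unary k ++ inp) rfl rfl ?_ h).to
      ?_ ?_
    · rw [update_join_inl, update_own_inp]
      exact (runs_inc_f.seq (runs_inc_i.seq ((runs_put _).seq runs_emit_i))).to rfl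
    · rw [show i + (k + 1) = i + 1 + k by omega, show f + (k + 1) = f + 1 + k by omega]
      simp [hadamards, List.range'_succ, NatGate.code]
    · rw [add_mul, one_mul]; omega

/-- Move the counter `i` to the counter `j`. -/
def restore : Prog tm := loop (.inl .i) id (fun _ => inc .j) skip

theorem runs_restore : restore.Runs (join (own inp out i j f s) R)
    (join (own inp out 0 (j + i) f s) R) (2 * i + 2) := by
  induction i generalizing j with
  | zero => exact (Runs.loop_nil rfl (runs_skip _)).to rfl
  | succ i ih =>
    refine (Runs.loop_i runs_inc_j ih).to ?_
    rw [Nat.add_right_comm, Nat.add_assoc]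

/-- Read a bit, emitting its gates. -/
def readBit : Prog tm :=
  (put [true, false, false]).seq ((emit .i).seq (ite (.inl .inp) id
    ((put [true, true, false]).seq ((emit .i).seq ((emit .f).seq ((inc .f).seq (emit .f))))) skip))

theorem runs_readBit (b : Bool) : readBit.Runs (join (own (b :: inp) out i j f 0) R)
    (join (own inp (out ++ codeGates (bitGates i f b)) i j (f + b.toNat) 0) R)
    (10 * i + 10 * f + 25) := by
  cases b with
  | false =>
    refine ((runs_put _).seq (runs_emit_i.seq
      (Runs.ite_false (x := false) (xs := inp) rfl rfl (runs_skip _)))).to ?_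
    rw [update_join_inl, update_own_inp]
    simp [bitGates, NatGate.code]
  | true =>
    -- Two pushes and the emission of `i`, `f` and `f + 1`.
    refine ((runs_put _).seq (runs_emit_i.seq (Runs.ite_true (t := 5 * i + 10 * f + 19)
      (S' := join (own inp (out ++ codeGates (bitGates i f true)) i j (f + 1) 0) R)
      (x := true) (xs := inp) rfl rfl ?_))).to rfl
    rw [update_join_inl, update_own_inp]
    refine ((runs_put _).seq (runs_emit_i.seq (runs_emit_f.seq
      (runs_inc_f.seq runs_emit_f)))).to ?_
    simp [bitGates, NatGate.code]

/-- Read the literals of a clause. -/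
def readLiterals : Prog tm :=
  loop (.inl .j) id (fun _ => (inc .i).seq (readBit.seq readBit)) skip

theorem runs_readLiterals (l : BitClause) {M : ℕ} (hi : i + l.length ≤ M) (hf : f + width l ≤ M) :
    readLiterals.Runs (join (own (codeClause l ++ inp) out i l.length f 0) R)
      (join (own inp (out ++ codeGates (varsGates i f l)) (i + l.length) 0 (f + width l) 0) R)
      (l.length * (40 * M + 60) + 2) := by
  induction l generalizing i f out with
  | nil =>
    refine (Runs.loop_nil rfl (runs_skip _)).to ?_
    simp [varsGates, codeClause, width]
  | cons p l ih =>
    simp only [width, List.length_cons] at hi hf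
    have h := ih (i := i + 1) (f := f + p.1.toNat + p.2.toNat)
      (out := out ++ codeGates (bitGates (i + 1) f p.1) ++
        codeGates (bitGates (i + 1) (f + p.1.toNat) p.2)) (by omega) (by omega)
    refine (Runs.loop_j (runs_inc_i.seq ((runs_readBit p.1).seq (runs_readBit p.2))) h).to ?_ ?_
    · rw [show i + (p :: l).length = i + 1 + l.length by simp only [List.length_cons]; omega,
        show f + width (p :: l) = f + p.1.toNat + p.2.toNat + width l by simp only [width]; omega]
      simp [varsGates]
    · simp only [List.length_cons, add_mul, one_mul]; omega

/-- Read a clause. -/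
def readClause : Prog tm :=
  (put [true, false, true, false]).seq ((emit .f).seq (readLiterals.seq
    ((put [true, false, true]).seq ((emit .f).seq ((put [false]).seq ((inc .f).seq restore))))))

/-- Each constant word emitted before a gate is the list mark `true` followed by the two kind bits;
a trailing or separate `false` is the unary code of qubit `0`. -/
theorem runs_readClause (l : BitClause) {M : ℕ} (hi : l.length ≤ M) (hf : f + width l ≤ M) :
    readClause.Runs (join (own (codeClause l ++ inp) out 0 l.length f 0) R)
      (join (own inp (out ++ codeGates (clauseGates f l)) 0 l.length (f + width l + 1) 0) R)
      (l.length * (40 * M + 60) + 12 * M + 16) := by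
  refine ((runs_put _).seq (runs_emit_f.seq ((runs_readLiterals l (M := M) (by omega) hf).seq
    ((runs_put _).seq (runs_emit_f.seq ((runs_put _).seq (runs_inc_f.seq runs_restore))))))).to
    ?_ (by omega)
  simp [clauseGates, NatGate.code]

/-- The clauses of a formula, each preceded by `true`, and a final `false`. -/
def codeClauses (ls : List BitClause) : List Bool := encodeList codeClause ls

theorem codeClauses_cons (l : BitClause) (ls : List BitClause) :
    codeClauses (l :: ls) = true :: (codeClause l ++ codeClauses ls) := by
  simp [codeClauses, encodeList]

/-- Read the clauses of a formula. -/
def readClauses : Prog tm := repeatWhile (.inl .inp) id readClause skip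

theorem runs_readClauses {n M : ℕ} {ls : List BitClause} (hn : ∀ l ∈ ls, l.length = n)
    (hM : n ≤ M) (hf : f + ancillas ls ≤ M) :
    readClauses.Runs (join (own (codeClauses ls) out 0 n f 0) R)
      (join (own [] (out ++ codeGates (formulaGates f ls)) 0 n (f + ancillas ls) 0) R)
      (ls.length * (n * (40 * M + 60) + 12 * M + 17) + 2) := by
  induction ls generalizing f out with
  | nil =>
    refine (Runs.while_false (x := false) (xs := []) rfl rfl (runs_skip _)).to ?_
    rw [update_join_inl, update_own_inp]
    simp [formulaGates, ancillas]
  | cons l ls ih =>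
    simp only [ancillas] at hf
    have hl := hn l List.mem_cons_self
    have h := ih (f := f + width l + 1) (out := out ++ codeGates (clauseGates f l))
      (fun l hl => hn l (List.mem_cons_of_mem _ hl)) (by omega)
    rw [codeClauses_cons]
    refine (Runs.while_true (t := n * (40 * M + 60) + 12 * M + 16) (x := true)
      (xs := codeClause l ++ codeClauses ls) rfl rfl ?_ h).to ?_ ?_
    · rw [update_join_inl, update_own_inp]
      subst hl
      exact runs_readClause l (by omega) (by omega)
    · simp [formulaGates, ancillas, Nat.add_assoc]
    · simp only [List.length_cons, add_mul, one_mul]; omega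

/-- Emit the gates of the circuit of a formula. -/
def readFormula (r : ℕ) : Prog tm :=
  readVars.seq (restore.seq ((put [true, false, false, false]).seq ((inc .f).seq (readClauses.seq
    ((put [true, false, true, false]).seq ((emit .f).seq ((inc .f).seq
      (put (codeGates (List.replicate r (.H 0)) ++ [false])))))))))

/-- A bound for the running time of `readFormula`. -/
def readTime (n m M : ℕ) : ℕ :=
  (n + 1) * (5 * M + 8) + m * (n * (40 * M + 60) + 12 * M + 17) + 2 * M + 20

/-- After the variables the counter `f` equals `n`. One increment accounts for qubit `0` and makes
it the first fresh qubit; the final increment turns the index of the last qubit into the number of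
qubits, which the header of the circuit code needs. -/
theorem runs_readFormula {n : ℕ} {ls : List BitClause} (hn : ∀ l ∈ ls, l.length = n) (r : ℕ) :
    (readFormula r).Runs (join (own (unary n ++ codeClauses ls) [] 0 0 0 0) R)
      (join (own [] (codeGates (satGates n ls r) ++ [false]) 0 n (lastQubit n ls + 1) 0) R)
      (readTime n ls.length (lastQubit n ls)) := by
  have hL : n + 1 + ancillas ls = lastQubit n ls := rfl
  have h₁ := runs_readVars (R := R) (inp := codeClauses ls) (out := []) (i := 0) (j := 0) (f := 0) n
    (M := lastQubit n ls) (by omega)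
  have h₂ := runs_restore (R := R) (inp := codeClauses ls)
    (out := [] ++ codeGates (hadamards 0 n)) (i := 0 + n) (j := 0) (f := 0 + n) (s := 0)
  rw [Nat.zero_add, List.nil_append] at h₁ h₂
  rw [Nat.zero_add] at h₂
  have h₃ := runs_readClauses (R := R) (f := n + 1)
    (out := codeGates (hadamards 0 n) ++ [true, false, false, false]) (M := lastQubit n ls) hn
    (by omega) hL.le
  rw [hL] at h₃
  refine (h₁.seq (h₂.seq ((runs_put _).seq (runs_inc_f.seq (h₃.seq ((runs_put _).seq
    (runs_emit_f.seq (runs_inc_f.seq (runs_put _))))))))).to ?_ ?_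
  · simp [satGates, NatGate.code]
  · simp only [readTime, add_mul, one_mul]
    omega

end Frag

/-! ### Calling the given machine and reading its answer -/

namespace Frag

section

variable {tm : FinTM2} {R : ∀ k, List (tm.Γ k)} {inp out : List Bool} {i j f s : ℕ}

/-- Move the emitted code to the input stack of `tm`. -/
def moveCode (e : tm.Γ tm.k₀ ≃ Bool) : Prog tm :=
  loop (.inl .out) id (fun b => push (.inr tm.k₀) [e.symm b]) skip

theorem runs_push_inr (k : tm.K) (x : tm.Γ k) (l : List (tm.Γ k)) (O : Own → List Bool) :
    (push (.inr k) [x] : Prog tm).Runs (join O (update (fun _ => []) k l))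
      (join O (update (fun _ => []) k (x :: l))) 1 := by
  refine (runs_push _ _ _).to ?_
  have : join O (update (fun _ => []) k l) (.inr k) = l := by simp [join]
  rw [this, update_join_inr]
  simp

theorem runs_moveCode (e : tm.Γ tm.k₀ ≃ Bool) (l : List (tm.Γ tm.k₀)) :
    (moveCode e).Runs (join (own inp out i j f s) (update (fun _ => []) tm.k₀ l))
      (join (own inp [] i j f s) (update (fun _ => []) tm.k₀ (out.map e.symm ++ l)))
      (2 * out.length + 2) := by
  induction out using List.reverseRecOn generalizing l with
  | nil => exact (Runs.loop_nil rfl (runs_skip _)).to rfl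
  | append_singleton out b ih =>
    refine (Runs.loop_cons (t := 1) (x := b) (xs := out.reverse) (by simp [join, own]) ?_
      (ih (e.symm b :: l))).to (by simp) (by simp; omega)
    rw [update_join_inl, update_own_out, List.reverse_reverse]
    exact runs_push_inr _ _ _ _

/-- Move the counter `f` to the input stack of `tm`. -/
def moveCounter (e : tm.Γ tm.k₀ ≃ Bool) : Prog tm :=
  (push (.inr tm.k₀) [e.symm false]).seq
    (loop (.inl .f) id (fun _ => push (.inr tm.k₀) [e.symm true]) skip)

/-- The number of qubits is known only once all ancillas are allocated. Pushed last, it still ends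
up in front of the gates, where the code of a circuit wants it. -/
theorem runs_moveCounter (e : tm.Γ tm.k₀ ≃ Bool) (l : List (tm.Γ tm.k₀)) :
    (moveCounter e).Runs (join (own inp out i j f s) (update (fun _ => []) tm.k₀ l))
      (join (own inp out i j 0 s) (update (fun _ => []) tm.k₀ ((unary f).map e.symm ++ l)))
      (2 * f + 3) := by
  have h (n : ℕ) (l : List (tm.Γ tm.k₀)) :
      (loop (.inl .f) id (fun _ => push (.inr tm.k₀) [e.symm true]) skip : Prog tm).Runs
        (join (own inp out i j n s) (update (fun _ => []) tm.k₀ l))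
        (join (own inp out i j 0 s)
          (update (fun _ => []) tm.k₀ (List.replicate n (e.symm true) ++ l))) (2 * n + 2) := by
    induction n generalizing l with
    | zero => exact (Runs.loop_nil rfl (runs_skip _)).to rfl
    | succ n ih =>
      refine (Runs.loop_f (runs_push_inr _ _ _ _) (ih _)).to ?_
      rw [List.replicate_succ', List.append_assoc, List.singleton_append]
  refine ((runs_push_inr _ _ _ _).seq (h f _)).to ?_
  simp [unary]

/-- Clear the counter `j`. -/
def clearJ : Prog tm := loop (.inl .j) id (fun _ => skip) skip

theorem runs_clearJ : clearJ.Runs (join (own inp out i j f s) R)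
    (join (own inp out i 0 f s) R) (2 * j + 2) := by
  induction j with
  | zero => exact (Runs.loop_nil rfl (runs_skip _)).to rfl
  | succ j ih => exact (Runs.loop_j (runs_skip _) ih).to rfl

/-- Clear the counter `s`. -/
def clearS : Prog tm := loop (.inl .s) id (fun _ => skip) skip

theorem runs_clearS : clearS.Runs (join (own inp out i j f s) R)
    (join (own inp out i j f 0) R) (2 * s + 2) := by
  induction s with
  | zero => exact (Runs.loop_nil rfl (runs_skip _)).to rfl
  | succ s ih => exact (Runs.loop_s (runs_skip _) ih).to rfl

/-- Clear the output stack of `tm`, and count its bits `true`. -/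
def scan (e : tm.Γ tm.k₁ ≃ Bool) : Prog tm :=
  loop (.inr tm.k₁) e (fun b => if b = true then inc .s else skip) skip

theorem runs_scan (e : tm.Γ tm.k₁ ≃ Bool) (w : List Bool) :
    (scan e).Runs (join (own inp out i j f s) (update (fun _ => []) tm.k₁ (w.map e.symm)))
      (join (own inp out i j f (s + w.count true)) fun _ => []) (2 * w.length + 2) := by
  induction w generalizing s with
  | nil =>
    refine (Runs.loop_nil (by simp [join]) (runs_skip _)).to ?_
    simp
  | cons b w ih =>
    refine Runs.to (Runs.loop_cons (k := Sum.inr tm.k₁) (Γ := Alph Own tm) (t := 1)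
      (x := e.symm b) (xs := w.map e.symm) (by simp [join]) ?_ (ih (s := s + b.toNat))) ?_ ?_
    · rw [update_join_inr, update_idem, e.apply_symm_apply]
      cases b
      · exact runs_skip _
      · exact runs_inc_s
    · cases b <;> simp [Nat.add_assoc, Nat.add_comm 1]
    · simp only [List.length_cons]; omega

/-- Write on the empty input stack whether the counter `s` is positive, and clear it. -/
def answer : Prog tm :=
  ite (.inl .s) id ((push (.inl .inp) [true]).seq clearS) (push (.inl .inp) [false])

theorem runs_answer : answer.Runs (join (own [] out i j f s) R)
    (join (own [decide (0 < s)] out i j f 0) R) (2 * s + 3) := by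
  have h (b : Bool) (s : ℕ) : (push (.inl .inp) [b] : Prog tm).Runs
      (join (own [] out i j f s) R) (join (own [b] out i j f s) R) 1 := by
    refine (runs_push _ _ _).to ?_
    rw [update_join_inl]
    exact congrArg (join · R) (update_own_inp [] out i j f s [b])
  cases s with
  | zero => exact (Runs.ite_nil rfl (h false 0)).to (by simp)
  | succ s =>
    refine (Runs.ite_true (t := 2 * s + 3) (x := true) (xs := List.replicate s true)
      rfl rfl ?_).to rfl
    rw [update_join_inl, update_own_s]
    exact ((h true s).seq runs_clearS).to (by simp)

end

/-- Translate a formula to a circuit, run `A`, and tell whether its output contains `true`. -/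
def decider (A : Machine) (r : ℕ) : Prog A.tm :=
  (readFormula r).seq ((moveCode A.inputAlphabet).seq ((moveCounter A.inputAlphabet).seq
    (clearJ.seq ((simulate Own A.tm).seq ((scan A.outputAlphabet).seq answer)))))

theorem runs_decider (A : Machine) (r : ℕ) {n : ℕ} {ls : List BitClause}
    (hn : ∀ l ∈ ls, l.length = n) {w : List Bool} {t : ℕ}
    (h : A.OutputsWithin (satCode n ls r) w t) :
    (decider A r).Runs (join (own (unary n ++ codeClauses ls) [] 0 0 0 0) fun _ => [])
      (join (own [decide (0 < w.count true)] [] 0 0 0 0) fun _ => [])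
      (readTime n ls.length (lastQubit n ls) + 2 * (satCode n ls r).length + 2 * n + t +
        4 * w.length + 20) := by
  have hu : update (fun _ => []) A.tm.k₀ [] = fun k => ([] : List (A.tm.Γ k)) := by simp
  have h₁ := runs_readFormula (R := fun k => ([] : List (A.tm.Γ k))) hn r
  have h₂ := runs_moveCode (inp := []) (out := codeGates (satGates n ls r) ++ [false]) (i := 0)
    (j := n) (f := lastQubit n ls + 1) (s := 0) A.inputAlphabet []
  have h₃ := runs_moveCounter (inp := []) (out := []) (i := 0)
    (j := n) (f := lastQubit n ls + 1) (s := 0) A.inputAlphabet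
    ((codeGates (satGates n ls r) ++ [false]).map A.inputAlphabet.symm)
  rw [hu, List.append_nil] at h₂
  rw [← List.map_append] at h₃
  have h₄ := runs_simulate h (own [] [] 0 0 0 0)
  -- Scanning costs two steps per bit, and clearing the count at most as much again, whence `4 *
  -- w.length`.
  have hc : w.count true ≤ w.length := List.count_le_length
  have hl : (satCode n ls r).length =
      lastQubit n ls + 2 + ((codeGates (satGates n ls r)).length + 1) := by
    simp [satCode, unary]
    omega
  refine (h₁.seq (h₂.seq (h₃.seq (runs_clearJ.seq (h₄.seq
    ((runs_scan A.outputAlphabet w).seq runs_answer)))))).to ?_ ?_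
  · simp
  · simp only [List.length_append, List.length_singleton]
    omega

end Frag

/-! ### The satisfiability machine -/

/-- The machine that decides the satisfiability of a formula, given a machine `A` that computes the
acceptance probabilities of circuits. -/
def satMachine (A : Machine) (r : ℕ) : Machine where
  tm :=
    { K := Own ⊕ A.tm.K
      kFin := @instFintypeSum _ _ _ A.tm.kFin
      k₀ := .inl .inp
      k₁ := .inl .inp
      Γ := Frag.Alph Own A.tm
      Λ := Option (Frag.decider A r).Λ
      main := some (Frag.decider A r).entry
      σ := Option Bool × A.tm.σ
      initialState := (none, default)
      σFin := @instFintypeProd _ _ _ A.tm.σFin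
      Γk₀Fin := inferInstanceAs (Fintype Bool)
      m := (Frag.decider A r).toProgram }
  inputAlphabet := Equiv.refl Bool
  outputAlphabet := Equiv.refl Bool

theorem satMachine_outputsWithin (A : Machine) (r : ℕ) {n : ℕ} {ls : List BitClause}
    (hn : ∀ l ∈ ls, l.length = n) {w : List Bool} {t : ℕ}
    (h : A.OutputsWithin (satCode n ls r) w t) :
    (satMachine A r).OutputsWithin (unary n ++ Frag.codeClauses ls) [decide (0 < w.count true)]
      (Frag.readTime n ls.length (lastQubit n ls) + 2 * (satCode n ls r).length + 2 * n + t +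
        4 * w.length + 21) := by
  have hs (l : List Bool) : (update (fun _ => []) (.inl .inp) l :
      ∀ k, List (Frag.Alph Own A.tm k)) = Frag.join (tm := A.tm) (own l [] 0 0 0 0) fun _ => [] := by
    funext k
    rcases k with c | k
    · cases c <;> simp [Frag.join, own]
    · simp [Frag.join]
  have hd := (Frag.runs_decider A r hn h).evalsTo
  rw [← hs, ← hs] at hd
  unfold Machine.OutputsWithin TM2OutputsInTime
  have h₁ (l : List Bool) : l.map (satMachine A r).inputAlphabet.invFun = l := List.map_id l
  have h₂ (l : List Bool) : l.map (satMachine A r).outputAlphabet.invFun = l := List.map_id l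
  rw [Option.map_some, Frag.initList_eq, Frag.haltList_eq, h₁, h₂]
  exact hd

/-! ### The acceptance probability of a circuit -/

namespace NatGate

/-- The gate as a gate on `N` qubits. -/
def toGate {N : ℕ} : (g : NatGate) → g.Valid N → Gate N
  | X t, h => .X ⟨t, h⟩
  | CNOT c t, h => .CNOT ⟨c, h.1⟩ ⟨t, h.2.1⟩ fun e => h.2.2 (congrArg Fin.val e)
  | TOFFOLI c d t, h => .TOFFOLI ⟨c, h.1⟩ ⟨d, h.2.1⟩ ⟨t, h.2.2.1⟩
      (fun e => h.2.2.2.1 (congrArg Fin.val e)) (fun e => h.2.2.2.2.1 (congrArg Fin.val e))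
      fun e => h.2.2.2.2.2 (congrArg Fin.val e)
  | H t, h => .H ⟨t, h⟩

/-- Is the gate a Hadamard gate? -/
def isH : NatGate → Bool
  | H _ => true
  | _ => false

/-- The action of a classical gate on assignments (Hadamard gates are ignored). -/
def act : NatGate → (ℕ → Bool) → ℕ → Bool
  | X t, z => update z t (!(z t))
  | CNOT c t, z => update z t (xor (z t) (z c))
  | TOFFOLI c d t, z => update z t (xor (z t) (z c && z d))
  | H _, z => z

theorem encodeGate_toGate {N : ℕ} (g : NatGate) (h : g.Valid N) :
    encodeGate (g.toGate h) = g.code := by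
  cases g <;> rfl

theorem isH_toGate {N : ℕ} (g : NatGate) (h : g.Valid N) : (g.toGate h).isH = g.isH := by
  cases g <;> rfl

end NatGate

/-- A list of gates as a circuit on `N` qubits. -/
def toCircuit {N : ℕ} (l : List NatGate) (h : ∀ g ∈ l, g.Valid N) : Circuit N :=
  l.pmap NatGate.toGate h

theorem encodeCircuit_toCircuit {N : ℕ} (l : List NatGate) (h : ∀ g ∈ l, g.Valid N) :
    encodeCircuit (toCircuit l h) = unary N ++ (codeGates l ++ [false]) := by
  have : (toCircuit l h).flatMap (fun x => true :: encodeGate x) = codeGates l := by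
    induction l with
    | nil => rfl
    | cons g l ih =>
      rw [codeGates_cons, ← ih fun g hg => h g (List.mem_cons_of_mem _ hg)]
      simp [toCircuit, NatGate.encodeGate_toGate]
  rw [encodeCircuit, encodeList, this]

theorem numH_toCircuit {N : ℕ} (l : List NatGate) (h : ∀ g ∈ l, g.Valid N) :
    Circuit.numH (toCircuit l h) = l.countP NatGate.isH := by
  induction l with
  | nil => rfl
  | cons g l ih =>
    have := ih fun g hg => h g (List.mem_cons_of_mem _ hg)
    simp only [Circuit.numH, toCircuit, List.pmap_cons, List.countP_cons,
      NatGate.isH_toGate] at this ⊢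
    rw [this]

/-- The action of a classical gate on basis labels (Hadamard gates are ignored). -/
def Gate.perm {N : ℕ} : Gate N → Bits N → Bits N
  | .X t, x => update x t (!(x t))
  | .CNOT c t _, x => update x t (xor (x t) (x c))
  | .TOFFOLI c d t _ _ _, x => update x t (xor (x t) (x c && x d))
  | .H _, x => x

theorem Gate.perm_involutive {N : ℕ} (g : Gate N) : Involutive g.perm := by
  intro x
  cases g with
  | X t => simp [Gate.perm]
  | CNOT c t h => simp [Gate.perm, h]
  | TOFFOLI c d t h₁ h₂ h₃ => simp [Gate.perm, h₂, h₃]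
  | H t => rfl

theorem classicalMatrix_mulVec {N : ℕ} {g : Bits N → Bits N} (hg : Involutive g)
    (ψ : Bits N → ℂ) (y : Bits N) : (classicalMatrix g).mulVec ψ y = ψ (g y) := by
  have h (x : Bits N) : y = g x ↔ g y = x :=
    ⟨fun e => by rw [e, hg], fun e => by rw [← e, hg]⟩
  simp [classicalMatrix, Matrix.mulVec, dotProduct, h]

theorem Gate.mulVec_of_not_isH {N : ℕ} {g : Gate N} (h : g.isH = false) (ψ : Bits N → ℂ)
    (y : Bits N) : g.matrix.mulVec ψ y = ψ (g.perm y) := by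
  rw [← classicalMatrix_mulVec g.perm_involutive ψ y]
  cases g with
  | H t => simp [Gate.isH] at h
  | _ => rfl

theorem Gate.mulVec_H {N : ℕ} (t : Fin N) (ψ : Bits N → ℂ) (y : Bits N) :
    (Gate.H t).matrix.mulVec ψ y =
      (ψ (update y t false) + (if y t = true then -1 else 1) * ψ (update y t true)) /
        ((Real.sqrt 2 : ℝ) : ℂ) := by
  have hs := Fintype.sum_of_injective (fun b : Bool => update y t b) (update_injective y t)
    (fun b => (if (b && y t) = true then (-1 : ℂ) else 1) / ((Real.sqrt 2 : ℝ) : ℂ) *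
      ψ (update y t b)) (fun x => (Gate.H t).matrix y x * ψ x) (fun x hx => ?_) fun b => ?_
  · rw [Matrix.mulVec, dotProduct, ← hs, Fintype.sum_bool]
    simp only [Bool.true_and, Bool.false_and, Bool.false_eq_true, if_false]
    ring
  · have : ¬ ∀ j, j ≠ t → y j = x j := by
      intro h
      refine hx ⟨x t, ?_⟩
      funext j
      by_cases e : j = t
      · subst e; simp
      · simp [e, h j e]
    simp [Gate.matrix, this]
  · have : ∀ j, j ≠ t → y j = update y t b j := fun j hj => by simp [hj]
    simp only [Gate.matrix, Matrix.of_apply, if_pos this, update_self]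

namespace Circuit

theorem mulVec_cons {N : ℕ} (g : Gate N) (V : Circuit N) (ψ : Bits N → ℂ) :
    (matrix (g :: V)).mulVec ψ = (matrix V).mulVec (g.matrix.mulVec ψ) := by
  rw [matrix, Matrix.mulVec_mulVec]

theorem mulVec_append {N : ℕ} (V W : Circuit N) (ψ : Bits N → ℂ) :
    (matrix (V ++ W)).mulVec ψ = (matrix W).mulVec ((matrix V).mulVec ψ) := by
  induction V generalizing ψ with
  | nil => simp [matrix]
  | cons g V ih => rw [List.cons_append, mulVec_cons, mulVec_cons, ih]

/-- The action of a classical circuit on basis labels. -/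
def run {N : ℕ} : Circuit N → Bits N → Bits N
  | [], x => x
  | g :: V, x => run V (g.perm x)

theorem run_bijective {N : ℕ} (V : Circuit N) : Bijective (run V) := by
  induction V with
  | nil => exact bijective_id
  | cons g V ih => exact ih.comp g.perm_involutive.bijective

/-- A classical circuit carries the amplitude of each label `x` unchanged to the label `run V x`. -/
theorem mulVec_run {N : ℕ} {V : Circuit N} (h : ∀ g ∈ V, g.isH = false) (ψ : Bits N → ℂ)
    (x : Bits N) : (matrix V).mulVec ψ (run V x) = ψ x := by
  induction V generalizing ψ x with
  | nil => simp [matrix, run]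
  | cons g V ih =>
    rw [mulVec_cons, run, ih fun g hg => h g (List.mem_cons_of_mem _ hg),
      Gate.mulVec_of_not_isH (h g List.mem_cons_self), g.perm_involutive]

end Circuit

/-- The squared norm of the part of a vector on which the last qubit is `1`. -/
noncomputable def lastWeight {N : ℕ} (ψ : Bits (N + 1) → ℂ) : ℝ :=
  ∑ y, if y (Fin.last N) = true then ‖ψ y‖ ^ 2 else 0

theorem Circuit.accProb_eq {N : ℕ} (V : Circuit (N + 1)) :
    accProb V = lastWeight ((matrix V).mulVec (zeroKet (N + 1))) := by
  rw [accProb, EuclideanSpace.norm_sq_eq, lastWeight]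
  refine Finset.sum_congr rfl fun y _ => ?_
  rw [WithLp.ofLp_toLp, lastOneProj, Matrix.mulVec_diagonal]
  split_ifs <;> simp

theorem lastWeight_run {N : ℕ} {V : Circuit (N + 1)} (h : ∀ g ∈ V, g.isH = false)
    (ψ : Bits (N + 1) → ℂ) : lastWeight ((Circuit.matrix V).mulVec ψ) =
      ∑ x, if Circuit.run V x (Fin.last N) = true then ‖ψ x‖ ^ 2 else 0 := by
  rw [lastWeight, ← (Circuit.run_bijective V).sum_comp]
  simp only [Circuit.mulVec_run h]

/-- Labels that differ only at `t` agree on the last qubit, and on such a pair the gate preserves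
the sum of squared norms by the parallelogram law. -/
theorem lastWeight_H {N : ℕ} {t : Fin (N + 1)} (ht : t ≠ Fin.last N) (ψ : Bits (N + 1) → ℂ) :
    lastWeight ((Gate.H t).matrix.mulVec ψ) = lastWeight ψ := by
  -- Summing over all labels counts each pair twice, which gives the factor `2`.
  have key (φ : Bits (N + 1) → ℂ) : 2 * lastWeight φ = ∑ y : Bits (N + 1),
      if y (Fin.last N) = true then
        ‖φ (update y t false)‖ ^ 2 + ‖φ (update y t true)‖ ^ 2 else 0 := by
    have h := (Gate.perm_involutive (Gate.X t)).bijective.sum_comp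
      fun y => if y (Fin.last N) = true then ‖φ y‖ ^ 2 else 0
    rw [two_mul]
    refine (congrArg (lastWeight φ + ·) h.symm).trans ?_
    simp only [lastWeight]
    rw [← Finset.sum_add_distrib]
    refine Finset.sum_congr rfl fun y _ => ?_
    simp only [Gate.perm, update_of_ne ht.symm]
    split_ifs
    · cases hy : y t
      · rw [Bool.not_false, show update y t false = y by rw [← hy, update_eq_self]]
      · rw [Bool.not_true, show update y t true = y by rw [← hy, update_eq_self], add_comm]
    · simp
  have h₂ : (2 : ℝ) * lastWeight ((Gate.H t).matrix.mulVec ψ) = 2 * lastWeight ψ := by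
    rw [key, key]
    refine Finset.sum_congr rfl fun y _ => ?_
    split_ifs
    · have hp := parallelogram_law_with_norm ℝ (ψ (update y t false)) (ψ (update y t true))
      have hq : Real.sqrt 2 ^ 2 = 2 := Real.sq_sqrt (by norm_num)
      rw [Gate.mulVec_H, Gate.mulVec_H]
      simp only [update_idem, update_self, Bool.false_eq_true, if_false, if_true, one_mul, neg_mul,
        norm_div, Complex.norm_real, div_pow, Real.norm_eq_abs, sq_abs, hq, ← sub_eq_add_neg]
      linarith
    · rfl
  linarith

theorem lastWeight_replicate_H {N : ℕ} {t : Fin (N + 1)} (ht : t ≠ Fin.last N) (r : ℕ)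
    (ψ : Bits (N + 1) → ℂ) :
    lastWeight ((Circuit.matrix (List.replicate r (Gate.H t))).mulVec ψ) = lastWeight ψ := by
  induction r generalizing ψ with
  | zero => simp [Circuit.matrix]
  | succ r ih => rw [List.replicate_succ, Circuit.mulVec_cons, ih, lastWeight_H ht]

/-! ### The Hadamard layer -/

/-- The uniform superposition of the labels supported on the qubits `1, …, k`. -/
noncomputable def uniformKet (N k : ℕ) : Bits N → ℂ := fun y =>
  if ∀ j : Fin N, y j = true → 1 ≤ j.val ∧ j.val ≤ k then (((Real.sqrt 2 : ℝ) : ℂ)⁻¹) ^ k else 0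

theorem uniformKet_zero (N : ℕ) : uniformKet N 0 = zeroKet N := by
  funext y
  have : (∀ j : Fin N, y j = true → 1 ≤ j.val ∧ j.val ≤ 0) ↔ y = fun _ => false := by
    constructor
    · intro h
      funext j
      by_contra hj
      have := h j (by simpa using hj)
      omega
    · rintro rfl j hj
      simp at hj
  simp only [uniformKet, zeroKet, this, pow_zero, Pi.single_apply]

/-- Qubit `k + 1` is still `0` on the support, so only one of the two terms of the Hadamard gate
survives. -/
theorem mulVec_uniformKet {N k : ℕ} (hk : k + 1 < N) :
    (Gate.H ⟨k + 1, hk⟩).matrix.mulVec (uniformKet N k) = uniformKet N (k + 1) := by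
  funext y
  have h₁ : uniformKet N k (update y ⟨k + 1, hk⟩ true) = 0 := by
    refine if_neg fun h => ?_
    have := (h ⟨k + 1, hk⟩ (by simp)).2
    simp at this
  have h₂ : (∀ j : Fin N, update y ⟨k + 1, hk⟩ false j = true → 1 ≤ j.val ∧ j.val ≤ k) ↔
      ∀ j : Fin N, y j = true → 1 ≤ j.val ∧ j.val ≤ k + 1 := by
    refine forall_congr' fun j => ?_
    by_cases hj : j = ⟨k + 1, hk⟩
    · subst hj; simp
    · have : j.val ≠ k + 1 := fun e => hj (Fin.ext e)
      rw [update_of_ne hj]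
      refine imp_congr_right fun _ => ?_
      omega
  rw [Gate.mulVec_H, h₁, mul_zero, add_zero]
  simp only [uniformKet, h₂]
  split_ifs
  · rw [pow_succ, div_eq_mul_inv]
  · simp

theorem hadamards_mulVec {N k i : ℕ} (h : ∀ g ∈ hadamards i k, g.Valid N) :
    (Circuit.matrix (toCircuit (hadamards i k) h)).mulVec (uniformKet N i) =
      uniformKet N (i + k) := by
  induction k generalizing i with
  | zero => simp [hadamards, toCircuit, Circuit.matrix]
  | succ k ih =>
    have h₁ : i + 1 < N := h (.H (i + 1)) (by simp [hadamards, List.range'_succ])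
    have h₂ : ∀ g ∈ hadamards (i + 1) k, g.Valid N := fun g hg =>
      h g (by
        simp only [hadamards, List.range'_succ, List.map_cons] at hg ⊢
        exact List.mem_cons_of_mem _ hg)
    have : toCircuit (hadamards i (k + 1)) h =
        Gate.H ⟨i + 1, h₁⟩ :: toCircuit (hadamards (i + 1) k) h₂ := by
      simp [toCircuit, hadamards, List.range'_succ, NatGate.toGate]
    rw [this, Circuit.mulVec_cons, mulVec_uniformKet, ih h₂, Nat.add_right_comm, Nat.add_assoc]

theorem norm_sq_uniformKet (N k : ℕ) (y : Bits N) : ‖uniformKet N k y‖ ^ 2 =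
    if ∀ j : Fin N, y j = true → 1 ≤ j.val ∧ j.val ≤ k then 1 / (2 : ℝ) ^ k else 0 := by
  simp only [uniformKet]
  split_ifs
  · rw [norm_pow, norm_inv, Complex.norm_real, Real.norm_eq_abs, ← pow_mul, mul_comm, pow_mul,
      inv_pow, sq_abs, Real.sq_sqrt (by norm_num), inv_pow, one_div]
  · simp

/-! ### Classical evaluation -/

/-- The action of a list of classical gates on assignments. -/
def acts : List NatGate → (ℕ → Bool) → ℕ → Bool
  | [], z => z
  | g :: l, z => acts l (g.act z)

theorem acts_append (l l' : List NatGate) (z : ℕ → Bool) :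
    acts (l ++ l') z = acts l' (acts l z) := by
  induction l generalizing z with
  | nil => rfl
  | cons g l ih => exact ih _

theorem perm_toGate {N : ℕ} (g : NatGate) (h : g.Valid N) (z : ℕ → Bool) :
    (g.toGate h).perm (fun i => z i) = fun i : Fin N => g.act z i := by
  have key (t : ℕ) (ht : t < N) (b : Bool) :
      update (fun i : Fin N => z i) ⟨t, ht⟩ b = fun i : Fin N => update z t b i := by
    funext i
    by_cases e : i = ⟨t, ht⟩
    · subst e; simp
    · rw [update_of_ne e, update_of_ne fun e' => e (Fin.ext e')]
  cases g with
  | H t => rfl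
  | _ => exact key _ _ _

theorem run_toCircuit {N : ℕ} (l : List NatGate) (h : ∀ g ∈ l, g.Valid N) (z : ℕ → Bool) :
    Circuit.run (toCircuit l h) (fun i => z i) = fun i : Fin N => acts l z i := by
  induction l generalizing z with
  | nil => rfl
  | cons g l ih =>
    simp only [toCircuit, List.pmap_cons, Circuit.run, perm_toGate, acts]
    exact ih (fun g hg => h g (List.mem_cons_of_mem _ hg)) _

/-- Are all literals of a list of variables, beginning with qubit `i + 1`, false? -/
def falsified (z : ℕ → Bool) : ℕ → BitClause → Bool
  | _, [] => true
  | i, (p, q) :: l => !(p && z (i + 1)) && !(q && !(z (i + 1))) && falsified z (i + 1) l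

theorem falsified_congr {z z' : ℕ → Bool} {i : ℕ} {l : BitClause}
    (h : ∀ k, i < k → k ≤ i + l.length → z' k = z k) : falsified z' i l = falsified z i l := by
  induction l generalizing i with
  | nil => rfl
  | cons p l ih =>
    simp only [List.length_cons] at h
    rw [falsified, falsified, h (i + 1) (by omega) (by omega),
      ih fun k h₁ h₂ => h k (by omega) (by omega)]

theorem acts_bitGates {z : ℕ → Bool} {i f : ℕ} {b : Bool} (hi : i < f)
    (hz : ∀ k, f < k → z k = false) :
    acts (bitGates i f b) z (f + b.toNat) = (z f && !(b && z i)) ∧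
    acts (bitGates i f b) z i = !(z i) ∧
    (∀ k, k ≤ f → k ≠ i → acts (bitGates i f b) z k = z k) ∧
    ∀ k, f + b.toNat < k → acts (bitGates i f b) z k = false := by
  cases b with
  | false =>
    refine ⟨?_, ?_, fun k _ hk => ?_, fun k hk => ?_⟩
    · simp [bitGates, acts, NatGate.act, hi.ne']
    · simp [bitGates, acts, NatGate.act]
    · simp [bitGates, acts, NatGate.act, hk]
    · have : k ≠ i := by simp at hk; omega
      simp [bitGates, acts, NatGate.act, this, hz k (by simpa using hk)]
  | true =>
    have h₁ : f + 1 ≠ i := by omega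
    have h₂ : i ≠ f + 1 := by omega
    refine ⟨?_, ?_, fun k hk hk' => ?_, fun k hk => ?_⟩
    · simp [bitGates, acts, NatGate.act, hi.ne', h₁, hz (f + 1) (by omega), Bool.and_comm]
    · simp [bitGates, acts, NatGate.act, h₂]
    · have : k ≠ f + 1 := by omega
      simp [bitGates, acts, NatGate.act, hk', this]
    · simp only [Bool.toNat_true] at hk
      have h₃ : k ≠ f + 1 := by omega
      have h₄ : k ≠ i := by omega
      simp [bitGates, acts, NatGate.act, h₃, h₄, hz k (by omega)]

/-- Each variable is toggled twice. After the first toggle its qubit holds the negation, which is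
the condition for the positive literal to fail; after the second it holds the variable again, the
condition for the negative literal to fail. The last two conclusions keep the induction going: old
qubits are intact and higher ones are still `0`. -/
theorem acts_varsGates {z : ℕ → Bool} {i f : ℕ} {l : BitClause} (hi : i + l.length < f)
    (hz : ∀ k, f < k → z k = false) :
    acts (varsGates i f l) z (f + width l) = (z f && falsified z i l) ∧
    (∀ k, k < f → acts (varsGates i f l) z k = z k) ∧
    ∀ k, f + width l < k → acts (varsGates i f l) z k = false := by
  induction l generalizing z i f with
  | nil => exact ⟨by simp [varsGates, acts, width, falsified], fun _ _ => rfl, hz⟩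
  | cons p l ih =>
    obtain ⟨p, q⟩ := p
    simp only [List.length_cons] at hi
    obtain ⟨a₁, a₂, a₃, a₄⟩ := acts_bitGates (i := i + 1) (b := p) (by omega) hz
    set z₁ := acts (bitGates (i + 1) f p) z
    obtain ⟨b₁, b₂, b₃, b₄⟩ := acts_bitGates (i := i + 1) (b := q) (by omega) a₄
    set z₂ := acts (bitGates (i + 1) (f + p.toNat) q) z₁
    have hz₂ : ∀ k, k < f → z₂ k = z k := by
      intro k hk
      by_cases e : k = i + 1
      -- The second toggle undoes the first.
      · subst e; rw [b₂, a₂, Bool.not_not]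
      · rw [b₃ k (by omega) e, a₃ k hk.le e]
    obtain ⟨c₁, c₂, c₃⟩ := ih (z := z₂) (i := i + 1) (f := f + p.toNat + q.toNat) (by omega) b₄
    have he : acts (varsGates i f ((p, q) :: l)) z =
        acts (varsGates (i + 1) (f + p.toNat + q.toNat) l) z₂ := by
      rw [varsGates, acts_append, acts_append]
    have hw : f + width ((p, q) :: l) = f + p.toNat + q.toNat + width l := by
      simp only [width]; omega
    rw [he, hw]
    refine ⟨?_, fun k hk => (c₂ k (by omega)).trans (hz₂ k hk), c₃⟩
    rw [c₁, b₁, a₁, a₂, falsified, falsified_congr fun k _ hk => hz₂ k (by omega)]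
    simp only [Bool.and_assoc]

/-- With `u` the value of qubit `0` and `v` telling whether the clause fails, the ancillas compute
`u && v`, and `xor u (u && v) = (u && !v)`. Qubit `0` is thus updated in place. -/
theorem acts_clauseGates {z : ℕ → Bool} {f : ℕ} {l : BitClause} (hl : l.length < f)
    (hz : ∀ k, f ≤ k → z k = false) :
    acts (clauseGates f l) z 0 = (z 0 && !(falsified z 0 l)) ∧
    (∀ k, 0 < k → k < f → acts (clauseGates f l) z k = z k) ∧
    ∀ k, f + width l + 1 ≤ k → acts (clauseGates f l) z k = false := by
  set z₁ := NatGate.act (.CNOT 0 f) z with hz₁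
  have h₁ : ∀ k, k ≠ f → z₁ k = z k := fun k hk => by simp [hz₁, NatGate.act, hk]
  have h₂ : z₁ f = z 0 := by simp [hz₁, NatGate.act, hz f le_rfl]
  obtain ⟨c₁, c₂, c₃⟩ := acts_varsGates (z := z₁) (i := 0) (f := f) (l := l) (by omega)
    fun k hk => (h₁ k hk.ne').trans (hz k hk.le)
  set z₂ := acts (varsGates 0 f l) z₁
  have he : acts (clauseGates f l) z = update z₂ 0 (xor (z₂ 0) (z₂ (f + width l))) := by
    rw [clauseGates, acts, acts_append]
    rfl
  rw [he]
  refine ⟨?_, fun k hk hk' => ?_, fun k hk => ?_⟩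
  · rw [update_self, c₁, h₂, c₂ 0 (by omega), h₁ 0 (by omega),
      falsified_congr fun k _ hk => h₁ k (by omega)]
    cases z 0 <;> simp
  · rw [update_of_ne hk.ne', c₂ k hk', h₁ k hk'.ne]
  · rw [update_of_ne (by omega), c₃ k (by omega)]

theorem acts_formulaGates {z : ℕ → Bool} {n f : ℕ} {ls : List BitClause} (hn : n < f)
    (hl : ∀ l ∈ ls, l.length = n) (hz : ∀ k, f ≤ k → z k = false) :
    acts (formulaGates f ls) z 0 = (z 0 && ls.all fun l => !(falsified z 0 l)) ∧
    ∀ k, f + ancillas ls ≤ k → acts (formulaGates f ls) z k = false := by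
  induction ls generalizing z f with
  | nil => exact ⟨by simp [formulaGates, acts], hz⟩
  | cons l ls ih =>
    have hl₁ := hl l List.mem_cons_self
    have hl₂ : ∀ l ∈ ls, l.length = n := fun l h => hl l (List.mem_cons_of_mem _ h)
    obtain ⟨c₁, c₂, c₃⟩ := acts_clauseGates (l := l) (by omega) hz
    obtain ⟨d₁, d₂⟩ := ih (f := f + width l + 1) (by omega) hl₂ c₃
    rw [formulaGates, acts_append]
    refine ⟨?_, fun k hk => d₂ k (by simp only [ancillas] at hk; omega)⟩
    have : (ls.all fun l' => !(falsified (acts (clauseGates f l) z) 0 l')) =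
        ls.all fun l' => !(falsified z 0 l') := by
      rw [Bool.eq_iff_iff, List.all_eq_true, List.all_eq_true]
      refine forall₂_congr fun l' h' => ?_
      rw [falsified_congr fun k h₁ h₂ => c₂ k h₁ (by rw [hl₂ l' h'] at h₂; omega)]
    rw [d₁, c₁, this, List.all_cons, Bool.and_assoc]

/-- The classical part of the circuit `satGates`. -/
def evalGates (n : ℕ) (ls : List BitClause) : List NatGate :=
  .X 0 :: (formulaGates (n + 1) ls ++ [.CNOT 0 (lastQubit n ls)])

theorem satGates_eq (n : ℕ) (ls : List BitClause) (r : ℕ) :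
    satGates n ls r = hadamards 0 n ++ (evalGates n ls ++ List.replicate r (.H 0)) := by
  simp [satGates, evalGates]

theorem acts_evalGates {z : ℕ → Bool} {n : ℕ} {ls : List BitClause} (h₀ : z 0 = false)
    (hl : ∀ l ∈ ls, l.length = n) (hz : ∀ k, n + 1 ≤ k → z k = false) :
    acts (evalGates n ls) z (lastQubit n ls) = ls.all fun l => !(falsified z 0 l) := by
  obtain ⟨c₁, c₂⟩ := acts_formulaGates (z := update z 0 true) (f := n + 1) (by omega) hl
    fun k hk => (update_of_ne (by omega) _ _).trans (hz k hk)
  have hf (l : BitClause) : falsified (update z 0 true) 0 l = falsified z 0 l :=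
    falsified_congr fun k h _ => update_of_ne h.ne' _ _
  have he : acts (evalGates n ls) z =
      NatGate.act (.CNOT 0 (lastQubit n ls)) (acts (formulaGates (n + 1) ls) (update z 0 true)) := by
    simp [evalGates, acts, acts_append, NatGate.act, h₀]
  rw [he, NatGate.act, update_self, c₂ (lastQubit n ls) le_rfl, c₁]
  simp [hf]

/-! ### The acceptance probability of the circuit of a formula -/

theorem not_isH_varsGates {i f : ℕ} {l : BitClause} :
    ∀ g ∈ varsGates i f l, g.isH = false := by
  have hb (i f : ℕ) (b : Bool) : ∀ g ∈ bitGates i f b, g.isH = false := by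
    cases b <;> simp [bitGates, NatGate.isH]
  induction l generalizing i f with
  | nil => simp [varsGates]
  | cons p l ih =>
    intro g hg
    simp only [varsGates, List.mem_append] at hg
    rcases hg with hg | hg | hg
    exacts [hb _ _ _ g hg, hb _ _ _ g hg, ih g hg]

theorem not_isH_formulaGates {f : ℕ} {ls : List BitClause} :
    ∀ g ∈ formulaGates f ls, g.isH = false := by
  induction ls generalizing f with
  | nil => simp [formulaGates]
  | cons l ls ih =>
    intro g hg
    simp only [formulaGates, clauseGates, List.mem_append, List.mem_cons, List.not_mem_nil,
      or_false] at hg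
    rcases hg with (rfl | hg | rfl) | hg
    exacts [rfl, not_isH_varsGates g hg, rfl, ih g hg]

theorem not_isH_evalGates {n : ℕ} {ls : List BitClause} :
    ∀ g ∈ evalGates n ls, g.isH = false := by
  intro g hg
  simp only [evalGates, List.mem_append, List.mem_cons, List.not_mem_nil, or_false] at hg
  rcases hg with rfl | hg | rfl
  exacts [rfl, not_isH_formulaGates g hg, rfl]

theorem countP_isH_satGates (n : ℕ) (ls : List BitClause) (r : ℕ) :
    (satGates n ls r).countP NatGate.isH = n + r := by
  have h₁ : (evalGates n ls).countP NatGate.isH = 0 :=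
    List.countP_eq_zero.2 fun g hg => by simp [not_isH_evalGates g hg]
  have h₂ : (hadamards 0 n).countP NatGate.isH = n := by
    rw [List.countP_eq_length.2 fun g hg => ?_, hadamards, List.length_map, List.length_range']
    obtain ⟨i, -, rfl⟩ := List.mem_map.1 hg
    rfl
  have h₃ : (List.replicate r (NatGate.H 0)).countP NatGate.isH = r := by
    rw [List.countP_replicate]; rfl
  rw [satGates_eq, List.countP_append, List.countP_append, h₁, h₂, h₃, Nat.zero_add]

/-- The assignment of the qubits `1, …, n` by `a`, and of all other qubits by `false`. -/
def spread {n : ℕ} (a : Fin n → Bool) (j : ℕ) : Bool :=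
  if h : 1 ≤ j ∧ j ≤ n then a ⟨j - 1, by omega⟩ else false

theorem spread_succ {n : ℕ} (a : Fin n → Bool) (i : Fin n) : spread a (i + 1) = a i := by
  have : 1 ≤ i.val + 1 ∧ i.val + 1 ≤ n := by omega
  rw [spread, dif_pos this]
  rfl

theorem spread_eq_false {n : ℕ} (a : Fin n → Bool) {j : ℕ} (h : ¬(1 ≤ j ∧ j ≤ n)) :
    spread a j = false := dif_neg h

/-- The circuit `satGates`. -/
def satCircuit {n : ℕ} {ls : List BitClause} (h : ∀ l ∈ ls, l.length = n) (r : ℕ) :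
    Circuit (lastQubit n ls + 1) :=
  toCircuit (satGates n ls r) (valid_satGates h r)

/-- The trailing Hadamard gates drop out, and the classical part permutes labels. What remains is a
sum over labels, supported on those of the form `spread a`, each of weight `1 / 2 ^ n`. -/
theorem accProb_satCircuit {n : ℕ} {ls : List BitClause} (h : ∀ l ∈ ls, l.length = n) (r : ℕ) :
    (satCircuit h r).accProb =
      ((∑ a : Fin n → Bool, (ls.all fun l => !(falsified (spread a) 0 l)).toNat : ℕ) : ℝ) /
        2 ^ n := by
  have hv := valid_satGates h r
  have hL : n + 1 ≤ lastQubit n ls := by simp only [lastQubit]; omega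
  have hv₁ : ∀ g ∈ hadamards 0 n, g.Valid (lastQubit n ls + 1) := fun g hg =>
    hv g (by rw [satGates_eq]; exact List.mem_append_left _ hg)
  have hv₂ : ∀ g ∈ evalGates n ls, g.Valid (lastQubit n ls + 1) := fun g hg =>
    hv g (by rw [satGates_eq]; exact List.mem_append_right _ (List.mem_append_left _ hg))
  have hV : satCircuit h r = toCircuit _ hv₁ ++ (toCircuit _ hv₂ ++ List.replicate r (.H 0)) := by
    have hr (h : ∀ g ∈ List.replicate r (NatGate.H 0), g.Valid (lastQubit n ls + 1)) :
        (List.replicate r (NatGate.H 0)).pmap NatGate.toGate h = List.replicate r (.H 0) := by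
      refine List.eq_replicate_iff.2 ⟨by simp, fun g hg => ?_⟩
      obtain ⟨g', hg', rfl⟩ := List.mem_pmap.1 hg
      obtain rfl := List.eq_of_mem_replicate hg'
      rfl
    simp only [satCircuit, toCircuit, satGates_eq, List.pmap_append, hr]
  have hH : ∀ g ∈ toCircuit _ hv₂, g.isH = false := by
    intro g hg
    obtain ⟨g', hg', rfl⟩ := List.mem_pmap.1 hg
    rw [NatGate.isH_toGate]
    exact not_isH_evalGates g' hg'
  have h0 : (0 : Fin (lastQubit n ls + 1)) ≠ Fin.last _ := by
    intro e
    have := congrArg Fin.val e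
    simp at this
    omega
  rw [Circuit.accProb_eq, hV, Circuit.mulVec_append, Circuit.mulVec_append,
    lastWeight_replicate_H h0, ← uniformKet_zero, hadamards_mulVec, lastWeight_run hH, Nat.zero_add]
  simp only [norm_sq_uniformKet]
  rw [Nat.cast_sum, Finset.sum_div]
  symm
  refine Fintype.sum_of_injective (fun (a : Fin n → Bool) (i : Fin (lastQubit n ls + 1)) =>
    spread a i) (fun a b hab => ?_) _ _ (fun x hx => ?_) fun a => ?_
  · funext i
    have := congrFun hab ⟨i + 1, by omega⟩
    simpa only [spread_succ] using this
  · have : ¬ ∀ j : Fin (lastQubit n ls + 1), x j = true → 1 ≤ j.val ∧ j.val ≤ n := by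
      intro hs
      refine hx ⟨fun i => x ⟨i + 1, by omega⟩, ?_⟩
      funext j
      by_cases hj : 1 ≤ j.val ∧ j.val ≤ n
      · simp only [spread, dif_pos hj]
        congr 1
        exact Fin.ext (Nat.sub_add_cancel hj.1)
      · simp only [spread, dif_neg hj]
        by_contra hx
        exact hj (hs j (by simpa using Ne.symm hx))
    rw [if_neg this, ite_self]
  · have h₁ : ∀ j : Fin (lastQubit n ls + 1), spread a j = true → 1 ≤ j.val ∧ j.val ≤ n := by
      intro j hj
      by_contra hc
      rw [spread_eq_false a hc] at hj
      simp at hj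
    have h₂ := acts_evalGates (z := spread a) (spread_eq_false a (by omega)) h
      fun k hk => spread_eq_false a (by omega)
    rw [run_toCircuit, if_pos h₁]
    simp only [Fin.val_last, h₂]
    cases (ls.all fun l => !(falsified (spread a) 0 l)) <;> simp

/-! ### Formulas -/

/-- The occurrences of the literals of a clause. -/
def bitClause {n : ℕ} (C : Clause n) : BitClause :=
  (List.finRange n).map fun i => (decide ((i, true) ∈ C), decide ((i, false) ∈ C))

theorem length_bitClause {n : ℕ} (C : Clause n) : (bitClause C).length = n := by
  simp [bitClause]

theorem length_of_mem_map_bitClause {n : ℕ} (f : CNF n) :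
    ∀ l ∈ f.map bitClause, l.length = n := by
  intro l hl
  obtain ⟨C, -, rfl⟩ := List.mem_map.1 hl
  exact length_bitClause C

theorem encodeCNF_eq {n : ℕ} (f : CNF n) :
    encodeCNF f = unary n ++ Frag.codeClauses (f.map bitClause) := by
  simp [encodeCNF, Frag.codeClauses, encodeList, List.flatMap_map, encodeClause, codeClause,
    bitClause]

theorem falsified_iff {z : ℕ → Bool} {i : ℕ} {l : BitClause} : falsified z i l = true ↔
    ∀ (k : ℕ) (hk : k < l.length), ¬(l[k].1 = true ∧ z (i + 1 + k) = true) ∧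
      ¬(l[k].2 = true ∧ z (i + 1 + k) = false) := by
  induction l generalizing i with
  | nil => simp [falsified]
  | cons p l ih =>
    rw [falsified, Bool.and_eq_true, ih]
    constructor
    · rintro ⟨h₁, h₂⟩ k hk
      cases k with
      | zero => simpa [imp_iff_not_or] using h₁
      | succ k =>
        have := h₂ k (by simpa using hk)
        rwa [Nat.add_right_comm] at this
    · intro h
      have h₀ := h 0 (by simp)
      refine ⟨by simpa [imp_iff_not_or, List.getElem_cons_zero] using h₀, fun k hk => ?_⟩
      have := h (k + 1) (by simpa using hk)
      rwa [← Nat.add_assoc, Nat.add_right_comm] at this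

theorem eval_eq {n : ℕ} (f : CNF n) (a : Fin n → Bool) :
    CNF.eval f a = (f.map bitClause).all fun l => !(falsified (spread a) 0 l) := by
  rw [CNF.eval, List.all_map]
  congr 1
  funext C
  have key : falsified (spread a) 0 (bitClause C) = true ↔ ¬∃ l ∈ C, a l.1 = l.2 := by
    rw [falsified_iff]
    constructor
    · rintro h ⟨⟨i, b⟩, hC, hi⟩
      have := h i (by simp [length_bitClause])
      rw [Nat.zero_add, Nat.add_comm, spread_succ] at this
      simp only at hi
      cases b <;> simp [bitClause, hC, hi] at this
    · intro h k hk
      rw [length_bitClause] at hk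
      have hs := spread_succ a ⟨k, hk⟩
      simp only at hs
      rw [Nat.zero_add, Nat.add_comm, hs]
      refine ⟨fun h' => h ⟨(⟨k, hk⟩, true), ?_, h'.2⟩, fun h' => h ⟨(⟨k, hk⟩, false), ?_, h'.2⟩⟩
      · simpa [bitClause] using h'.1
      · simpa [bitClause] using h'.1
  simp only [Function.comp_apply]
  by_cases h : ∃ l ∈ C, a l.1 = l.2
  · have : falsified (spread a) 0 (bitClause C) = false := by
      rw [← Bool.not_eq_true, key]; exact not_not.2 h
    rw [this, decide_eq_true h]; rfl
  · rw [key.2 h, decide_eq_false h]; rfl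

/-! ### Padding, and positivity of binary expansions -/

/-- The formula with `r` additional variables that do not occur in it. -/
def pad {n : ℕ} (f : CNF n) (r : ℕ) : CNF (n + r) :=
  f.map fun C => C.image fun l => (Fin.castAdd r l.1, l.2)

theorem count_pad {n : ℕ} (f : CNF n) (r : ℕ) : (pad f r).count = f.count * 2 ^ r := by
  have h (a : Fin n → Bool) (b : Fin r → Bool) :
      CNF.eval (pad f r) (Fin.append a b) = CNF.eval f a := by
    simp [CNF.eval, pad, List.all_map, Function.comp_def]
  rw [CNF.count, ← (Fin.appendEquiv n r).sum_comp, Fintype.sum_prod_type]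
  simp [Fin.appendEquiv, h, CNF.count, Finset.mul_sum, mul_comm]

theorem binaryValue_nonneg (w : List Bool) : 0 ≤ binaryValue w := by
  induction w with
  | nil => exact le_rfl
  | cons b w ih => rw [binaryValue]; split_ifs <;> linarith

/-- All bits contribute nonnegatively, so positivity can be read off without arithmetic, whichever
expansion is output. -/
theorem binaryValue_pos_iff (w : List Bool) : 0 < binaryValue w ↔ 0 < w.count true := by
  induction w with
  | nil => simp [binaryValue]
  | cons b w ih =>
    have := binaryValue_nonneg w
    cases b with
    | false => simp [binaryValue, ih]
    | true =>
      simp only [binaryValue, if_true, List.count_cons_self]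
      exact ⟨fun _ => Nat.succ_pos _, fun _ => by linarith⟩

/-! ### Growth of running times -/

theorem isLittleO_polynomial_pow (P : Polynomial ℕ) {r : ℝ} (hr : 1 < r) :
    (fun n : ℕ => ((P.eval n : ℕ) : ℝ)) =o[atTop] fun n : ℕ => r ^ n := by
  induction P using Polynomial.induction_on' with
  | add p q hp hq => simpa using hp.add hq
  | monomial k c =>
    have := (isLittleO_pow_const_const_pow_of_one_lt (R := ℝ) k hr).const_mul_left (c : ℝ)
    simpa using this

/-- The shift by `r` is the constant factor `(2 ^ (1 - a)) ^ r`; passing from `1 - a` to `1 - a / 2`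
absorbs it along with `C` and the polynomial. -/
theorem isLittleO_time (P : Polynomial ℕ) (C r : ℕ) {a : ℝ} (ha : 0 < a) (ha' : a < 1) :
    (fun n : ℕ => ((P.eval n + C * ⌊(2 : ℝ) ^ ((1 - a) * ((n + r : ℕ) : ℝ))⌋₊ : ℕ) : ℝ))
      =o[atTop] fun n : ℕ => (2 : ℝ) ^ ((1 - a / 2) * (n : ℝ)) := by
  have h₁ (b : ℝ) (n : ℕ) : (2 : ℝ) ^ (b * (n : ℝ)) = ((2 : ℝ) ^ b) ^ n := by
    rw [Real.rpow_mul (by norm_num), Real.rpow_natCast]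
  have h₂ : (2 : ℝ) ^ (1 - a) < 2 ^ (1 - a / 2) :=
    Real.rpow_lt_rpow_of_exponent_lt (by norm_num) (by linarith)
  simp only [h₁]
  have h₃ := isLittleO_polynomial_pow P (r := (2 : ℝ) ^ (1 - a / 2))
    (Real.one_lt_rpow (by norm_num) (by linarith))
  have h₄ := (isLittleO_pow_pow_of_lt_left (Real.rpow_nonneg (by norm_num) _) h₂).const_mul_left
    (C * ((2 : ℝ) ^ (1 - a)) ^ r)
  refine ((Asymptotics.isBigO_of_le _ fun n => ?_).trans_isLittleO (h₃.add h₄))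
  have h₅ := Nat.floor_le (a := ((2 : ℝ) ^ (1 - a)) ^ (n + r)) (by positivity)
  rw [Real.norm_of_nonneg (by positivity), Real.norm_of_nonneg (by positivity), Nat.cast_add,
    Nat.cast_mul]
  have h₆ := mul_le_mul_of_nonneg_left h₅ (Nat.cast_nonneg' (α := ℝ) C)
  rw [pow_add] at h₆ ⊢
  linarith

theorem lastQubit_le {n m : ℕ} {ls : List BitClause} (h : ∀ l ∈ ls, l.length = n)
    (hm : ls.length ≤ m) : lastQubit n ls ≤ n + 1 + m * (2 * n + 1) := by
  have h₁ := ancillas_le h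
  have h₂ := Nat.mul_le_mul_right (2 * n + 1) hm
  simp only [lastQubit]
  omega

theorem length_satCode_le {n m : ℕ} {ls : List BitClause} (h : ∀ l ∈ ls, l.length = n)
    (hm : ls.length ≤ m) (r : ℕ) : (satCode n ls r).length ≤
      n + 1 + m * (2 * n + 1) + 3 +
        (n + m * (4 * n + 2) + 2 + r) * (3 * (n + 1 + m * (2 * n + 1) + 1) + 3) := by
  have h₁ := length_codeGates_le (valid_satGates h r)
  have h₂ := length_satGates_le h r
  have h₃ := lastQubit_le h hm
  have h₄ : (satGates n ls r).length * (3 * (lastQubit n ls + 1) + 3) ≤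
      (n + m * (4 * n + 2) + 2 + r) * (3 * (n + 1 + m * (2 * n + 1) + 1) + 3) := by
    refine Nat.mul_le_mul (h₂.trans ?_) (by omega)
    gcongr
  simp only [satCode, unary, List.length_append, List.length_replicate, List.length_singleton]
  omega

theorem readTime_mono {n m m' M M' : ℕ} (hm : m ≤ m') (hM : M ≤ M') :
    Frag.readTime n m M ≤ Frag.readTime n m' M' := by
  unfold Frag.readTime
  gcongr

open Polynomial in
/-- A polynomial bound for the running time of `satMachine` on formulas with `n` variables and
at most `d n` clauses, except for the simulation of the given machine and the reading of its
output. -/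
noncomputable def overhead (d r : ℕ) : ℕ[X] :=
  ((X + 1) * (5 * (X + 1 + C d * X * (2 * X + 1)) + 8) +
      C d * X * (X * (40 * (X + 1 + C d * X * (2 * X + 1)) + 60) +
        12 * (X + 1 + C d * X * (2 * X + 1)) + 17) + 2 * (X + 1 + C d * X * (2 * X + 1)) + 20) +
    6 * (X + 1 + C d * X * (2 * X + 1) + 3 + (X + C d * X * (4 * X + 2) + 2 + C r) *
      (3 * (X + 1 + C d * X * (2 * X + 1) + 1) + 3)) + 2 * X + 21

theorem le_eval_overhead {n d : ℕ} {ls : List BitClause} (h : ∀ l ∈ ls, l.length = n)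
    (hd : ls.length ≤ d * n) (r : ℕ) :
    Frag.readTime n ls.length (lastQubit n ls) + 6 * (satCode n ls r).length + 2 * n + 21 ≤
      (overhead d r).eval n := by
  have h₁ := readTime_mono (n := n) hd (lastQubit_le h hd)
  have h₂ := length_satCode_le h hd r
  unfold Frag.readTime at h₁
  simp only [overhead, Polynomial.eval_add, Polynomial.eval_mul, Polynomial.eval_X,
    Polynomial.eval_C, Polynomial.eval_one, Polynomial.eval_ofNat]
  unfold Frag.readTime
  omega

/-- If the machine `A` computes the acceptance probability of the circuit of a formula, then
`satMachine` decides the satisfiability of the formula. -/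
theorem satMachine_decides (A : Machine) {B : ℕ} (hB : ∀ (s : List (A.tm.Γ A.tm.k₀))
    (s' : List (A.tm.Γ A.tm.k₁)) (t : ℕ), Nonempty (Turing.TM2OutputsInTime A.tm s (some s') t) →
      s'.length ≤ s.length + B * t) {n d : ℕ} (f : CNF n) (hf : f.length ≤ d * n) (r : ℕ) {b : ℝ}
    (h : A.ComputesAccProbWithin (satCircuit (length_of_mem_map_bitClause f) r) b) :
    (satMachine A r).OutputsWithin (encodeCNF f) [decide (0 < f.count)]
      ((overhead d r).eval n + (1 + 4 * B) * ⌊b⌋₊) := by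
  have hl := length_of_mem_map_bitClause f
  obtain ⟨t, w, ht, hw, hv⟩ := h
  rw [satCircuit, encodeCircuit_toCircuit] at hw
  change A.OutputsWithin (satCode n (f.map bitClause) r) w t at hw
  -- In the term `4 * w.length` of the running time, this yields four more code lengths, six in all,
  -- and the `4 * B` in the factor of `⌊b⌋₊`.
  have hwl : w.length ≤ (satCode n (f.map bitClause) r).length + B * t := by
    simpa using hB _ _ _ hw
  have hp : 0 < w.count true ↔ 0 < f.count := by
    rw [← binaryValue_pos_iff, hv, accProb_satCircuit]
    simp only [← eval_eq]
    rw [← CNF.count, div_pos_iff_of_pos_right (by positivity), Nat.cast_pos]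
  have hT := satMachine_outputsWithin A r hl hw
  rw [← encodeCNF_eq, decide_eq_decide.2 hp] at hT
  obtain ⟨⟨e, he⟩⟩ := hT
  refine ⟨⟨e, he.trans ?_⟩⟩
  have h₁ := le_eval_overhead hl (by simpa using hf) r
  have h₂ : t ≤ ⌊b⌋₊ := Nat.le_floor ht
  have h₃ := Nat.mul_le_mul_left (1 + 4 * B) h₂
  rw [add_mul, one_mul, mul_assoc] at h₃
  omega

end FineGrained

/-! ### The contradiction with SETH -/

theorem theorem10 (hSETH : FineGrained.SETH) (a : ℝ) (ha : 0 < a) :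
    ∃ p : Polynomial ℕ, ∀ A : FineGrained.Machine,
      ∃ᶠ h : ℕ in Filter.atTop,
        ∃ (N : ℕ) (V : FineGrained.Circuit (N + 1)) (f : FineGrained.CNF h),
          N + 1 ≤ p.eval h ∧ V.length ≤ p.eval h ∧
          FineGrained.Circuit.numH V = h ∧
          FineGrained.Circuit.accProb V = (FineGrained.CNF.count f : ℝ) / 2 ^ h ∧
          ¬ A.ComputesAccProbWithin V ((2 : ℝ) ^ ((1 - a) * (h : ℝ))) := by
  -- The exponent estimates want `a < 1`. Decreasing `a` only relaxes the time limit imposed on `A`.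
  obtain ⟨b, hb, hb₁, hba⟩ : ∃ b : ℝ, 0 < b ∧ b < 1 ∧ b ≤ a :=
    ⟨min a (1 / 2), by positivity, (min_le_right _ _).trans_lt (by norm_num), min_le_left _ _⟩
  obtain ⟨c, -, hc⟩ := hSETH (b / 2) (by positivity)
  obtain ⟨d, hd⟩ := exists_nat_ge c
  -- The polynomial depends on `d` alone and is fixed before `A`. The threshold `r`, which depends
  -- on `A`, is absorbed because `p` is evaluated at `n + r`.
  refine ⟨.X + .C 2 + .C d * .X * (.C 4 * .X + .C 2), fun A => ?_⟩
  by_contra hA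
  -- The threshold beyond which `A` succeeds is also the number of redundant Hadamard gates.
  obtain ⟨r, hr⟩ := eventually_atTop.1 (not_frequently.1 hA)
  obtain ⟨B, hB⟩ := FineGrained.exists_length_output_le A.tm
  refine hc (FineGrained.satMachine A r) (fun n => (FineGrained.overhead d r).eval n +
    (1 + 4 * B) * ⌊(2 : ℝ) ^ ((1 - b) * ((n + r : ℕ) : ℝ))⌋₊) (fun n f hf => ?_) ?_
  · have hl := FineGrained.length_of_mem_map_bitClause f
    have hfd : f.length ≤ d * n := by
      have : (f.length : ℝ) ≤ d * n := hf.trans (by gcongr)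
      exact_mod_cast this
    refine FineGrained.satMachine_decides A hB f hfd r ?_
    by_contra hV
    have hfd' : (f.map FineGrained.bitClause).length ≤ d * n := by simpa using hfd
    -- The circuit is built from `f` itself; the padded formula only witnesses that its acceptance
    -- probability has denominator `2 ^ (n + r)`.
    refine hr (n + r) (by omega) ⟨_, FineGrained.satCircuit hl r, FineGrained.pad f r, ?_, ?_, ?_,
      ?_, fun ⟨t, w, ht, hw⟩ => hV ⟨t, w, ht.trans ?_, hw⟩⟩
    · refine (Nat.succ_le_succ (FineGrained.lastQubit_le hl hfd')).trans ?_
      simp only [Polynomial.eval_add, Polynomial.eval_mul, Polynomial.eval_X, Polynomial.eval_C]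
      have : d * n * (2 * n + 1) ≤ d * (n + r) * (4 * (n + r) + 2) := by gcongr <;> omega
      omega
    · rw [FineGrained.satCircuit, FineGrained.toCircuit, List.length_pmap]
      refine (FineGrained.length_satGates_le hl r).trans ?_
      simp only [Polynomial.eval_add, Polynomial.eval_mul, Polynomial.eval_X, Polynomial.eval_C]
      have : (f.map FineGrained.bitClause).length * (4 * n + 2) ≤
          d * (n + r) * (4 * (n + r) + 2) := by
        gcongr
        · exact hfd'.trans (by gcongr; omega)
        · omega
      omega
    · rw [FineGrained.satCircuit, FineGrained.numH_toCircuit, FineGrained.countP_isH_satGates]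
    · rw [FineGrained.accProb_satCircuit, FineGrained.count_pad]
      simp only [← FineGrained.eval_eq]
      rw [← FineGrained.CNF.count, pow_add, Nat.cast_mul, Nat.cast_pow, Nat.cast_ofNat,
        mul_div_mul_right _ _ (by positivity)]
    -- Since `b ≤ a`, the time limit for `a` lies within the one for `b`.
    · exact Real.rpow_le_rpow_of_exponent_le (by norm_num) (by gcongr)
  · filter_upwards [(FineGrained.isLittleO_time (FineGrained.overhead d r) (1 + 4 * B) r hb
      hb₁).bound one_pos] with n hn
    rw [one_mul, Real.norm_of_nonneg (by positivity), Real.norm_of_nonneg (by positivity)] at hn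
    exact not_lt.2 hn
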